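/- Let $k,d\ge 0$ be integers, $n=k+d$, and let $\Theta$ be a real antisymmetric $n\times n$ matrix. Put $\sigma_\Theta(p,q)=e^{-\pi i\langle p,\Theta q\rangle}$ for $p,q\in\mathbb N^n$ (with $0\in\mathbb N$). Let $L_p$ be the isometry of $\ell^2(\mathbb N^n)$ with $L_p\delta_q=\sigma_\Theta(p,q)\,\delta_{p+q}$, and let $\mathcal T_r(\mathbb N^n,\sigma_\Theta)\subseteq B(\ell^2(\mathbb N^n))$ be the C*-algebra generated by $\{L_p : p\in\mathbb N^n\}$. Let $r=(r_1,\dots,r_k,0,\dots,0)\in[0,\infty)^n$ with $r_1,\dots,r_k>0$, and let $\alpha$ be the dynamics $\alpha_t(X)=u_tXu_t^*$, where $u_t\delta_q=e^{i\langle q,r\rangle t}\delta_q$; thus $\alpha_t(L_p)=e^{i\langle p,r\rangle t}L_p$. For $0<\beta<\infty$, a state $\varphi$ of $\mathcal T_r(\mathbb N^n,\sigma_\Theta)$ is a $\mathrm{KMS}_\beta$ state if $\varphi(AB)=\varphi(B\,\alpha_{i\beta}(A))$ for every $B$ and every $\alpha$-analytic $A$ (that is, every $A$ for which $t\mapsto\alpha_t(A)$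 extends to an entire function $z\mapsto\alpha_z(A)$). Let $Q=\prod_{j=1}^k(1-L_{e_j}L_{e_j}^*)$, which is a projection in $\mathcal T_r(\mathbb N^n,\sigma_\Theta)$. Let $0<\beta<\infty$. Then $Z(\beta)=\sum_{l\in\mathbb N^k\times 0_d}e^{-\beta\langle l,r\rangle}$ converges. For each tracial state $\omega$ of the corner $Q\,\mathcal T_r(\mathbb N^n,\sigma_\Theta)\,Q$ and each $X\in\mathcal T_r(\mathbb N^n,\sigma_\Theta)$, the series $$T_\beta(\omega)(X)=\frac1{Z(\beta)}\sum_{l\in\mathbb N^k\times 0_d}e^{-\beta\langle l,r\rangle}\,\omega(QL_l^*XL_lQ)$$ converges absolutely. The map $T_\beta$ is an affine weak* homeomorphism of the tracial state space of $Q\,\mathcal T_r(\mathbb N^n,\sigma_\Theta)\,Q$ onto the $\mathrm{KMS}_\beta$ state space of $(\mathcal T_r(\mathbb N^n,\sigma_\Theta),\alpha)$. -/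

import Mathlib

open scoped ComplexOrder

namespace ToeplitzTorus

noncomputable section

/-- The Hilbert space `ℓ²(ι)`. -/
abbrev Ell2 (ι : Type) : Type := lp (fun _ : ι => ℂ) 2

/-- The canonical orthonormal basis vector `δ_q` of `ℓ²(ι)`. -/
def delta {ι : Type} [DecidableEq ι] (q : ι) : Ell2 ι := lp.single 2 q (1 : ℂ)

theorem orthonormal_monomial {ι : Type} [DecidableEq ι] (f : ι → ι) (hf : Function.Injective f)
    (c : ι → Circle) :
    Orthonormal ℂ (fun q => (c q : ℂ) • (delta (f q) : Ell2 ι)) := by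
  rw [orthonormal_iff_ite]
  intro i j
  rw [inner_smul_left, inner_smul_right, delta, delta, lp.inner_single_left]
  by_cases h : i = j
  · subst h
    simp [← Circle.coe_inv_eq_conj]
  · have h' : f i ≠ f j := fun e => h (hf e)
    simp [h, h']

/-- The isometry of `ℓ²(ι)` with `δ_q ↦ c q • δ_{f q}`, for `f` injective and `c` circle-valued. -/
def monomialOp {ι : Type} [DecidableEq ι] (f : ι → ι) (hf : Function.Injective f)
    (c : ι → Circle) : Ell2 ι →L[ℂ] Ell2 ι :=
  (orthonormal_monomial f hf c).orthogonalFamily.linearIsometry.toContinuousLinearMap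

theorem monomialOp_delta {ι : Type} [DecidableEq ι] (f : ι → ι) (hf : Function.Injective f)
    (c : ι → Circle) (q : ι) :
    monomialOp f hf c (delta q) = (c q : ℂ) • delta (f q) := by
  simp [monomialOp, delta, OrthogonalFamily.linearIsometry_apply_single]

theorem op_ext {ι : Type} [DecidableEq ι] {S T : Ell2 ι →L[ℂ] Ell2 ι}
    (h : ∀ q, S (delta q) = T (delta q)) : S = T := by
  refine lp.ext_continuousLinearMap (by norm_num) fun q => ?_
  ext1
  exact h q

theorem vec_ext {ι : Type} [DecidableEq ι] {v w : Ell2 ι}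
    (h : ∀ q, inner ℂ (delta q) v = inner ℂ (delta q) w) : v = w := by
  ext q
  have := h q
  simpa [delta, lp.inner_single_left] using this

theorem inner_delta {ι : Type} [DecidableEq ι] (p q : ι) :
    inner ℂ (delta p : Ell2 ι) (delta q) = if p = q then 1 else 0 := by
  rw [delta, delta, lp.inner_single_left]
  by_cases h : p = q
  · subst h; simp
  · simp [h]

/-- The pairing `⟨p, r⟩ = ∑ⱼ pⱼ rⱼ` of `p ∈ ℕⁿ` with `r ∈ ℝⁿ`. -/
def pairing {n : ℕ} (p : Fin n → ℕ) (r : Fin n → ℝ) : ℝ := ∑ j, (p j : ℝ) * r j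

/-- `σ_Θ(p, q) = exp(-π i ⟨p, Θ q⟩)`. -/
def sigma {n : ℕ} (Θ : Matrix (Fin n) (Fin n) ℝ) (p q : Fin n → ℕ) : Circle :=
  Circle.exp (-(Real.pi * pairing p (Θ.mulVec fun j => (q j : ℝ))))

/-- The left regular isometry `L_p` on `ℓ²(ℕⁿ)`, with `L_p δ_q = σ_Θ(p, q) δ_{p+q}`. -/
def L {n : ℕ} (Θ : Matrix (Fin n) (Fin n) ℝ) (p : Fin n → ℕ) :
    Ell2 (Fin n → ℕ) →L[ℂ] Ell2 (Fin n → ℕ) :=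
  monomialOp (fun q => p + q) (add_right_injective p) (fun q => sigma Θ p q)

theorem L_delta {n : ℕ} (Θ : Matrix (Fin n) (Fin n) ℝ) (p q : Fin n → ℕ) :
    L Θ p (delta q) = (sigma Θ p q : ℂ) • delta (p + q) :=
  monomialOp_delta _ _ _ _

/-- The Toeplitz noncommutative torus `𝒯_r(ℕⁿ, σ_Θ)`: the C*-subalgebra of `B(ℓ²(ℕⁿ))` generated
by the operators `L_p`. It contains the identity, since `L_0 = 1`. -/
def toeplitz {n : ℕ} (Θ : Matrix (Fin n) (Fin n) ℝ) :
    StarSubalgebra ℂ (Ell2 (Fin n → ℕ) →L[ℂ] Ell2 (Fin n → ℕ)) :=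
  (StarAlgebra.adjoin ℂ (Set.range (L Θ))).topologicalClosure

theorem L_zero {n : ℕ} (Θ : Matrix (Fin n) (Fin n) ℝ) : L Θ 0 = 1 :=
  op_ext fun q => by simp [L_delta, sigma, pairing]

theorem L_mem {n : ℕ} (Θ : Matrix (Fin n) (Fin n) ℝ) (p : Fin n → ℕ) : L Θ p ∈ toeplitz Θ :=
  StarSubalgebra.le_topologicalClosure _ (StarAlgebra.subset_adjoin ℂ _ ⟨p, rfl⟩)

/-- `L_p` as an element of the Toeplitz noncommutative torus. -/
def gen {n : ℕ} (Θ : Matrix (Fin n) (Fin n) ℝ) (p : Fin n → ℕ) : toeplitz Θ :=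
  ⟨L Θ p, L_mem Θ p⟩

/-! ### The dynamics -/

/-- The diagonal unitary `u_t^r`, with `u_t^r δ_q = exp(i ⟨q, r⟩ t) δ_q`. -/
def uOp {n : ℕ} (r : Fin n → ℝ) (t : ℝ) : Ell2 (Fin n → ℕ) →L[ℂ] Ell2 (Fin n → ℕ) :=
  monomialOp id Function.injective_id (fun q => Circle.exp (pairing q r * t))

theorem uOp_delta {n : ℕ} (r : Fin n → ℝ) (t : ℝ) (q : Fin n → ℕ) :
    uOp r t (delta q) = (Circle.exp (pairing q r * t) : ℂ) • delta q :=
  monomialOp_delta _ _ _ _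

theorem star_uOp {n : ℕ} (r : Fin n → ℝ) (t : ℝ) : star (uOp r t) = uOp r (-t) := by
  refine op_ext fun q => vec_ext fun p => ?_
  rw [ContinuousLinearMap.star_eq_adjoint, ContinuousLinearMap.adjoint_inner_right, uOp_delta,
    uOp_delta, inner_smul_left, inner_smul_right, inner_delta]
  by_cases h : p = q
  · subst h
    rw [← Circle.coe_inv_eq_conj, ← Circle.exp_neg, mul_neg]
  · simp [h]

theorem uOp_mul {n : ℕ} (r : Fin n → ℝ) (s t : ℝ) : uOp r s * uOp r t = uOp r (s + t) := by
  refine op_ext fun q => ?_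
  rw [mul_apply_eq_comp, uOp_delta, map_smul, uOp_delta, uOp_delta, smul_smul,
    mul_add, Circle.exp_add, Circle.coe_mul, mul_comm]

theorem uOp_zero {n : ℕ} (r : Fin n → ℝ) : uOp r 0 = 1 :=
  op_ext fun q => by simp [uOp_delta]

theorem uOp_mul_L {n : ℕ} (Θ : Matrix (Fin n) (Fin n) ℝ) (r : Fin n → ℝ) (t : ℝ)
    (p : Fin n → ℕ) :
    uOp r t * L Θ p * uOp r (-t) = (Circle.exp (pairing p r * t) : ℂ) • L Θ p := by
  refine op_ext fun q => ?_
  have h : pairing (p + q) r = pairing p r + pairing q r := by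
    simp [pairing, add_mul, Finset.sum_add_distrib]
  rw [mul_apply_eq_comp, mul_apply_eq_comp, uOp_delta, map_smul, map_smul,
    smul_apply, L_delta, map_smul, uOp_delta, h, add_mul, Circle.exp_add,
    smul_smul, smul_smul, smul_smul, mul_neg, Circle.exp_neg]
  congr 1
  have := Circle.coe_ne_zero (Circle.exp (pairing q r * t))
  simp only [Circle.coe_mul, Circle.coe_inv]
  field_simp

/-- `u_t^r` as an element of the unitary group of `B(ℓ²(ℕⁿ))`. -/
def uUnitary {n : ℕ} (r : Fin n → ℝ) (t : ℝ) :
    unitary (Ell2 (Fin n → ℕ) →L[ℂ] Ell2 (Fin n → ℕ)) :=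
  ⟨uOp r t, by
    rw [Unitary.mem_iff, star_uOp, uOp_mul, uOp_mul]
    simp [uOp_zero]⟩

/-- Conjugation `X ↦ u_t^r X (u_t^r)*`, an automorphism of `B(ℓ²(ℕⁿ))`. -/
def conj {n : ℕ} (r : Fin n → ℝ) (t : ℝ) :
    (Ell2 (Fin n → ℕ) →L[ℂ] Ell2 (Fin n → ℕ)) ≃⋆ₐ[ℂ] (Ell2 (Fin n → ℕ) →L[ℂ] Ell2 (Fin n → ℕ)) :=
  Unitary.conjStarAlgAut ℂ _ (uUnitary r t)

theorem conj_apply {n : ℕ} (r : Fin n → ℝ) (t : ℝ)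
    (X : Ell2 (Fin n → ℕ) →L[ℂ] Ell2 (Fin n → ℕ)) :
    conj r t X = uOp r t * X * uOp r (-t) := by
  simp [conj, Unitary.conjStarAlgAut_apply, uUnitary, star_uOp]

theorem conj_mem {n : ℕ} (Θ : Matrix (Fin n) (Fin n) ℝ) (r : Fin n → ℝ) (t : ℝ)
    {X : Ell2 (Fin n → ℕ) →L[ℂ] Ell2 (Fin n → ℕ)} (hX : X ∈ toeplitz Θ) :
    conj r t X ∈ toeplitz Θ := by
  have hc : Continuous (conj r t) := by
    have : (conj r t : _ → _) = fun X => uOp r t * X * uOp r (-t) := funext (conj_apply r t)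
    rw [this]
    fun_prop
  have h1 : StarAlgebra.adjoin ℂ (Set.range (L Θ)) ≤
      (toeplitz Θ).comap (conj r t : _ →⋆ₐ[ℂ] _) := by
    rw [StarAlgebra.adjoin_le_iff]
    rintro _ ⟨p, rfl⟩
    change conj r t (L Θ p) ∈ toeplitz Θ
    rw [conj_apply, uOp_mul_L]
    exact SMulMemClass.smul_mem _ (L_mem Θ p)
  refine StarSubalgebra.topologicalClosure_minimal h1 ?_ hX
  exact (StarSubalgebra.isClosed_topologicalClosure _).preimage hc

/-- The automorphism `α_t^r` of the Toeplitz noncommutative torus. -/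
def dyn {n : ℕ} (Θ : Matrix (Fin n) (Fin n) ℝ) (r : Fin n → ℝ) (t : ℝ) :
    toeplitz Θ →⋆ₐ[ℂ] toeplitz Θ where
  toFun X := ⟨conj r t X, conj_mem Θ r t X.2⟩
  map_one' := by ext1; simp
  map_mul' X Y := by ext1; simp
  map_zero' := by ext1; simp
  map_add' X Y := by ext1; simp
  commutes' c := Subtype.ext (AlgHomClass.commutes (conj r t) c)
  map_star' X := by ext1; simp [map_star]

theorem dyn_gen {n : ℕ} (Θ : Matrix (Fin n) (Fin n) ℝ) (r : Fin n → ℝ) (t : ℝ) (p : Fin n → ℕ) :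
    dyn Θ r t (gen Θ p) = (Circle.exp (pairing p r * t) : ℂ) • gen Θ p := by
  ext1
  change conj r t (L Θ p) = _
  rw [conj_apply, uOp_mul_L]
  rfl

theorem dyn_zero {n : ℕ} (Θ : Matrix (Fin n) (Fin n) ℝ) (r : Fin n → ℝ) (X : toeplitz Θ) :
    dyn Θ r 0 X = X := by
  ext1
  change conj r 0 X = X
  simp [conj_apply, uOp_zero]

theorem dyn_add {n : ℕ} (Θ : Matrix (Fin n) (Fin n) ℝ) (r : Fin n → ℝ) (s t : ℝ)
    (X : toeplitz Θ) : dyn Θ r (s + t) X = dyn Θ r s (dyn Θ r t X) := by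
  ext1
  change conj r (s + t) X = conj r s (conj r t X)
  rw [conj_apply, conj_apply, conj_apply, ← uOp_mul, neg_add_rev, ← uOp_mul]
  simp only [mul_assoc]

/-! ### States -/

/-- The states of a C*-algebra `A` whose unit is the element `e`, inside the weak* dual:
positive linear functionals `φ` with `φ(e) = 1`. -/
def states (A : Type) [NonUnitalNormedRing A] [StarRing A] [NormedSpace ℂ A] (e : A) :
    Set (WeakDual ℂ A) :=
  {φ | (∀ a : A, 0 ≤ φ (star a * a)) ∧ φ e = 1}

/-- The tracial states of a C*-algebra `A` whose unit is the element `e`. -/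
def tracialStates (A : Type) [NonUnitalNormedRing A] [StarRing A] [NormedSpace ℂ A] (e : A) :
    Set (WeakDual ℂ A) :=
  {φ | φ ∈ states A e ∧ ∀ a b : A, φ (a * b) = φ (b * a)}

/-- `F : ℂ → A` is the entire extension `z ↦ α_z(a)` of the orbit `t ↦ α_t(a)`.
An element `a` is `α`-analytic iff such an `F` exists, and `F` is then unique. -/
def IsEntireOrbit {A : Type} [NormedRing A] [NormedSpace ℂ A] (α : ℝ → A → A) (a : A)
    (F : ℂ → A) : Prop :=
  Differentiable ℂ F ∧ ∀ t : ℝ, F (t : ℂ) = α t a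

/-- The `KMS_β` states of `(A, α)`: states with `φ(a b) = φ(b α_{iβ}(a))` for all `α`-analytic `a`
and all `b`. -/
def kmsStates (A : Type) [NormedRing A] [StarRing A] [NormedAlgebra ℂ A] (α : ℝ → A → A) (β : ℝ) :
    Set (WeakDual ℂ A) :=
  {φ | φ ∈ states A 1 ∧ ∀ (a b : A) (F : ℂ → A), IsEntireOrbit α a F →
    φ (a * b) = φ (b * F (Complex.I * β))}

/-! ### The corner -/

theorem rangeProj_delta {n : ℕ} (Θ : Matrix (Fin n) (Fin n) ℝ) (p q : Fin n → ℕ)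
    [Decidable (p ≤ q)] :
    (L Θ p * star (L Θ p)) (delta q) = if p ≤ q then delta q else 0 := by
  rw [mul_apply_eq_comp, ContinuousLinearMap.star_eq_adjoint]
  split_ifs with h
  · obtain ⟨s, rfl⟩ := exists_add_of_le h
    have h1 : delta (p + s) = L Θ p (((sigma Θ p s)⁻¹ : Circle) • delta s : Ell2 (Fin n → ℕ)) := by
      rw [Circle.smul_def, map_smul, L_delta, smul_smul, ← Circle.coe_mul]
      simp
    have h2 : (ContinuousLinearMap.adjoint (L Θ p)) ∘L L Θ p = 1 :=
      (ContinuousLinearMap.norm_map_iff_adjoint_comp_self _).mp fun x =>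
        LinearIsometry.norm_map _ x
    rw [h1]
    congr 1
    exact DFunLike.congr_fun h2 _
  · have : ContinuousLinearMap.adjoint (L Θ p) (delta q) = 0 := by
      refine vec_ext fun s => ?_
      rw [ContinuousLinearMap.adjoint_inner_right, L_delta, inner_smul_left, inner_delta,
        if_neg (fun e : p + s = q => h (e ▸ le_self_add)), mul_zero, inner_zero_right]
    rw [this, map_zero]

/-- The factor `1 - L_{e_j} L_{e_j}*`. -/
def factor {n : ℕ} (Θ : Matrix (Fin n) (Fin n) ℝ) (j : Fin n) : toeplitz Θ :=
  1 - gen Θ (Pi.single j 1) * star (gen Θ (Pi.single j 1))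

theorem factor_delta {n : ℕ} (Θ : Matrix (Fin n) (Fin n) ℝ) (j : Fin n) (q : Fin n → ℕ) :
    (factor Θ j : Ell2 (Fin n → ℕ) →L[ℂ] Ell2 (Fin n → ℕ)) (delta q) =
      if q j = 0 then delta q else 0 := by
  have h1 : (factor Θ j : Ell2 (Fin n → ℕ) →L[ℂ] Ell2 (Fin n → ℕ)) =
    1 - L Θ (Pi.single j 1) * star (L Θ (Pi.single j 1)) := rfl
  have h2 : (Pi.single j 1 : Fin n → ℕ) ≤ q ↔ q j ≠ 0 := by
    constructor
    · intro h
      have := h j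
      simp at this
      omega
    · intro h i
      by_cases hi : i = j
      · subst hi; simp; omega
      · simp [hi]
  classical
  rw [h1, sub_apply, rangeProj_delta, one_apply_eq_self]
  by_cases h : q j = 0 <;> simp [h, h2]

/-- The projection `Q = ∏_{j ≤ k} (1 - L_{e_j} L_{e_j}*)`, the factors in increasing order. -/
def Q {k d : ℕ} (Θ : Matrix (Fin (k + d)) (Fin (k + d)) ℝ) : toeplitz Θ :=
  (List.ofFn fun j : Fin k => factor Θ (Fin.castAdd d j)).prod

theorem prod_factor_delta {n : ℕ} (Θ : Matrix (Fin n) (Fin n) ℝ) (q : Fin n → ℕ)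
    (l : List (Fin n)) :
    (((l.map (factor Θ)).prod : toeplitz Θ) : Ell2 (Fin n → ℕ) →L[ℂ] Ell2 (Fin n → ℕ)) (delta q) =
      if ∀ j ∈ l, q j = 0 then delta q else 0 := by
  induction l with
  | nil => simp
  | cons a l ih =>
    rw [List.map_cons, List.prod_cons, MulMemClass.coe_mul, mul_apply_eq_comp, ih]
    by_cases h : ∀ j ∈ l, q j = 0
    · rw [if_pos h, factor_delta]
      by_cases ha : q a = 0 <;> simp [ha]
      exact fun j hj hq => absurd (h j hj) hq
    · rw [if_neg h, map_zero, if_neg]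
      exact fun h' => h fun j hj => h' j (List.mem_cons_of_mem _ hj)

theorem Q_delta {k d : ℕ} (Θ : Matrix (Fin (k + d)) (Fin (k + d)) ℝ) (q : Fin (k + d) → ℕ) :
    (Q Θ : Ell2 (Fin (k + d) → ℕ) →L[ℂ] Ell2 (Fin (k + d) → ℕ)) (delta q) =
      if ∀ j : Fin k, q (Fin.castAdd d j) = 0 then delta q else 0 := by
  have h : Q Θ = ((List.ofFn fun j : Fin k => Fin.castAdd d j).map (factor Θ)).prod := by
    rw [List.map_ofFn]; rfl
  rw [h, prod_factor_delta]
  simp [List.mem_ofFn]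

theorem Q_isStarProjection {k d : ℕ} (Θ : Matrix (Fin (k + d)) (Fin (k + d)) ℝ) :
    IsStarProjection (Q Θ) := by
  constructor
  · refine Subtype.ext (op_ext fun q => ?_)
    rw [MulMemClass.coe_mul, mul_apply_eq_comp, Q_delta]
    split_ifs with h
    · rw [Q_delta, if_pos h]
    · rw [map_zero]
  · refine Subtype.ext (op_ext fun q => vec_ext fun p => ?_)
    rw [StarMemClass.coe_star, ContinuousLinearMap.star_eq_adjoint,
      ContinuousLinearMap.adjoint_inner_right, Q_delta, Q_delta]
    by_cases hpq : p = q
    · subst hpq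
      split_ifs <;> simp
    · split_ifs <;> simp [inner_delta, hpq]

/-- The corner `e A e = {e a e | a ∈ A}` of a *-algebra at a projection `e`. -/
def corner {A : Type} [Ring A] [StarRing A] [Algebra ℂ A] [StarModule ℂ A] (e : A)
    (he : IsStarProjection e) : NonUnitalStarSubalgebra ℂ A where
  carrier := Set.range fun a => e * a * e
  add_mem' := by
    rintro _ _ ⟨a, rfl⟩ ⟨b, rfl⟩
    exact ⟨a + b, by simp [mul_add, add_mul]⟩
  zero_mem' := ⟨0, by simp⟩
  mul_mem' := by
    rintro _ _ ⟨a, rfl⟩ ⟨b, rfl⟩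
    exact ⟨a * e * e * b, by simp [mul_assoc]⟩
  smul_mem' := by
    rintro c _ ⟨a, rfl⟩
    exact ⟨c • a, by simp⟩
  star_mem' := by
    rintro _ ⟨a, rfl⟩
    exact ⟨star a, by simp [he.isSelfAdjoint.star_eq, mul_assoc]⟩

/-- The corner `Q 𝒯_r(ℕⁿ, σ_Θ) Q`. -/
abbrev cornerQ {k d : ℕ} (Θ : Matrix (Fin (k + d)) (Fin (k + d)) ℝ) :
    NonUnitalStarSubalgebra ℂ (toeplitz Θ) :=
  corner (Q Θ) (Q_isStarProjection Θ)

/-- The compression `X ↦ Q X Q` as a map into the corner. -/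
def compress {k d : ℕ} (Θ : Matrix (Fin (k + d)) (Fin (k + d)) ℝ) (X : toeplitz Θ) : cornerQ Θ :=
  ⟨Q Θ * X * Q Θ, X, rfl⟩

theorem coe_compress_one {k d : ℕ} (Θ : Matrix (Fin (k + d)) (Fin (k + d)) ℝ) :
    (compress Θ 1 : toeplitz Θ) = Q Θ := by
  change Q Θ * 1 * Q Θ = Q Θ
  rw [mul_one]
  exact (Q_isStarProjection Θ).isIdempotentElem

/-- The tracial state space of the corner; the unit of the corner is `Q = Q 1 Q`. -/
def cornerTraces {k d : ℕ} (Θ : Matrix (Fin (k + d)) (Fin (k + d)) ℝ) :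
    Set (WeakDual ℂ (cornerQ Θ)) :=
  tracialStates (cornerQ Θ) (compress Θ 1)

/-- The `KMS_β` state space of `(𝒯_r(ℕⁿ, σ_Θ), α^r)`. -/
def toeplitzKMS {n : ℕ} (Θ : Matrix (Fin n) (Fin n) ℝ) (r : Fin n → ℝ) (β : ℝ) :
    Set (WeakDual ℂ (toeplitz Θ)) :=
  kmsStates (toeplitz Θ) (fun t X => dyn Θ r t X) β

/-! ### The map `T_β` -/

/-- The inclusion of `ℕᵏ` into `ℕᵏ⁺ᵈ` as `ℕᵏ × 0_d`. -/
def incl {k : ℕ} (d : ℕ) (l : Fin k → ℕ) : Fin (k + d) → ℕ := Fin.append l 0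

/-- The weight `exp(-β ⟨l, r⟩)`, for `l ∈ ℕᵏ × 0_d`. -/
def weight {k d : ℕ} (r : Fin (k + d) → ℝ) (β : ℝ) (l : Fin k → ℕ) : ℝ :=
  Real.exp (-(β * pairing (incl d l) r))

/-- `Z(β) = ∑_{l ∈ ℕᵏ × 0_d} exp(-β ⟨l, r⟩)`. -/
def Z {k d : ℕ} (r : Fin (k + d) → ℝ) (β : ℝ) : ℝ :=
  ∑' l : Fin k → ℕ, weight (d := d) r β l

/-- The summand `exp(-β ⟨l, r⟩) ω(Q L_l* X L_l Q)`. -/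
def term {k d : ℕ} (Θ : Matrix (Fin (k + d)) (Fin (k + d)) ℝ) (r : Fin (k + d) → ℝ) (β : ℝ)
    (ω : WeakDual ℂ (cornerQ Θ)) (X : toeplitz Θ) (l : Fin k → ℕ) : ℂ :=
  (weight (d := d) r β l : ℂ) * ω (compress Θ (star (gen Θ (incl d l)) * X * gen Θ (incl d l)))

/-- `T_β(ω)(X) = Z(β)⁻¹ ∑_{l ∈ ℕᵏ × 0_d} exp(-β ⟨l, r⟩) ω(Q L_l* X L_l Q)`. -/
def Tfun {k d : ℕ} (Θ : Matrix (Fin (k + d)) (Fin (k + d)) ℝ) (r : Fin (k + d) → ℝ) (β : ℝ)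
    (ω : WeakDual ℂ (cornerQ Θ)) (X : toeplitz Θ) : ℂ :=
  (Z (d := d) r β : ℂ)⁻¹ * ∑' l : Fin k → ℕ, term Θ r β ω X l

end

end ToeplitzTorus

namespace ToeplitzTorus

noncomputable section

/-! ### Positive functionals -/

section PositiveFunctional

variable {A : Type*} [CStarAlgebra A]

/-! The projections `L_l Q L_l*`, for `l ∈ ℕᵏ × 0_d`, are pairwise orthogonal and sum strongly to
`1`. A KMS state gives them masses proportional to `exp(-β⟨l, r⟩)`, and cycling by the KMS condition
carries each block back to the corner of `Q`. So a KMS state is determined by its restriction to the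
corner, which the dynamics fixes pointwise and on which the state is therefore tracial.

From traces to KMS states: write `p = a + u`, with `a` in the first `k` coordinates and `u` in the
last `d`. Since `Q L_l* L_a = 0` unless `a ≤ l`, shifting the sum by `a` turns `L_a X` into `X L_a`
at the cost of the weight of `a` (`Tfun_incl_mul`). The isometry `L_u` commutes with `Q`, and with
`L_l` up to a phase that cancels, so the trace property moves it across (`term_tail_comm`). Together
these give the KMS identity on generators (`Tfun_gen_mul`). It passes to words in the `L_p` and
`L_p*`, and an identity-theorem argument extends it to all analytic elements
(`mem_toeplitzKMS_of_gen`).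

From KMS states to traces: `φ(Q)` is the reciprocal of `Z(β)` (`Z_mul_map_Q`), so `Z(β) φ` restricts
to a tracial state of the corner. The finite sums of the `L_l Q L_l*` have `φ`-mass tending to `1`,
and Cauchy–Schwarz then recovers `φ(X)` as the series (`hasSum_of_mem_kms`). Conversely, on the
corner only the term `l = 0` of the series survives (`Z_mul_Tfun_coe`). Restriction is visibly weak*
continuous, and `T_β` is so by uniform convergence. -/

theorem exists_selfAdjoint_sqrt (b : A) : ∃ s : A, star s = s ∧ s * s = star b * b := by
  have hb : IsSelfAdjoint (star b * b) := .star_mul_self b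
  refine ⟨cfc Real.sqrt (star b * b), (cfc_predicate Real.sqrt (star b * b) : IsSelfAdjoint _), ?_⟩
  rw [← cfc_mul Real.sqrt Real.sqrt (star b * b)]
  conv_rhs => rw [← cfc_id' ℝ (star b * b)]
  exact cfc_congr fun x hx => Real.mul_self_sqrt (spectrum_star_mul_self_nonneg x hx)

/-- The spectrum of `b* b` is bounded by `‖b‖²`. Positivity of functionals is only assumed on
elements `a* a`, so the inequality `b* b ≤ ‖b‖²` is needed as an explicit square. -/
theorem exists_selfAdjoint_sqrt_sub (b : A) :
    ∃ s : A, star s = s ∧ s * s = algebraMap ℝ A (‖b‖ ^ 2) - star b * b := by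
  nontriviality A
  have hb : IsSelfAdjoint (star b * b) := .star_mul_self b
  refine ⟨cfc (fun x : ℝ => Real.sqrt (‖b‖ ^ 2 - x)) (star b * b),
    (cfc_predicate _ (star b * b) : IsSelfAdjoint _), ?_⟩
  rw [← cfc_mul _ _ (star b * b)]
  conv_rhs => rw [← cfc_id' ℝ (star b * b), ← cfc_const _ (star b * b), ← cfc_sub _ _ (star b * b)]
  refine cfc_congr fun x hx => Real.mul_self_sqrt ?_
  have := spectrum.norm_le_norm_of_mem hx
  rw [CStarRing.norm_star_mul_self, Real.norm_eq_abs] at this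
  nlinarith [le_abs_self x]

variable {φ : A →ₗ[ℂ] ℂ}

/-- Polarization: `φ` is real on the squares of `1 + a` and `1 + i a`, and the cross terms give one
real equation each. -/
theorem map_star_of_nonneg (hφ : ∀ a, 0 ≤ φ (star a * a)) (a : A) :
    φ (star a) = star (φ a) := by
  have h0 := (Complex.nonneg_iff.mp (hφ a)).2
  have h1 := (Complex.nonneg_iff.mp (hφ 1)).2
  have h2 := (Complex.nonneg_iff.mp (hφ (1 + a))).2
  have h3 := (Complex.nonneg_iff.mp (hφ (1 + Complex.I • a))).2
  simp only [star_add, star_one, star_smul, add_mul, mul_add, mul_one, one_mul, map_add,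
    smul_mul_assoc, mul_smul_comm, map_smul, Complex.add_im, smul_eq_mul, Complex.mul_im,
    Complex.star_def, Complex.conj_I, Complex.I_re, Complex.I_im, Complex.neg_re, Complex.neg_im,
    Complex.mul_re] at h0 h1 h2 h3
  apply Complex.ext
  · simp only [Complex.star_def, Complex.conj_re]; linarith
  · simp only [Complex.star_def, Complex.conj_im]; linarith

/-- The semidefinite inner product `⟨a, b⟩ = φ(a* b)` of a positive functional `φ`. -/
@[reducible]
def gnsCore (hφ : ∀ a, 0 ≤ φ (star a * a)) : PreInnerProductSpace.Core ℂ A where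
  inner a b := φ (star a * b)
  conj_inner_symm a b := by
    rw [← Complex.star_def, ← map_star_of_nonneg hφ, star_mul, star_star]
  re_inner_nonneg a := (Complex.nonneg_iff.mp (hφ a)).1
  add_left a b c := by rw [star_add, add_mul, map_add]
  smul_left a b c := by
    rw [star_smul, smul_mul_assoc, map_smul, smul_eq_mul, Complex.star_def]

theorem norm_map_star_mul_sq_le (hφ : ∀ a, 0 ≤ φ (star a * a)) (a b : A) :
    ‖φ (star a * b)‖ ^ 2 ≤ (φ (star a * a)).re * (φ (star b * b)).re := by
  have h := @InnerProductSpace.Core.inner_mul_inner_self_le ℂ A _ _ _ (gnsCore hφ) a b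
  have e : φ (star b * a) = star (φ (star a * b)) := by
    rw [← map_star_of_nonneg hφ, star_mul, star_star]
  change ‖φ (star a * b)‖ * ‖φ (star b * a)‖ ≤ (φ (star a * a)).re * (φ (star b * b)).re at h
  rw [e, norm_star] at h
  rwa [sq]

theorem re_map_star_mul_self_le (hφ : ∀ a, 0 ≤ φ (star a * a)) (a : A) :
    (φ (star a * a)).re ≤ ‖a‖ ^ 2 * (φ 1).re := by
  obtain ⟨s, hs, hss⟩ := exists_selfAdjoint_sqrt_sub a
  have h := hφ s
  rw [hs, hss, map_sub, Algebra.algebraMap_eq_smul_one, ← Complex.coe_smul, map_smul] at h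
  have := (Complex.nonneg_iff.mp h).1
  rw [Complex.sub_re, smul_eq_mul, Complex.re_ofReal_mul] at this
  linarith

theorem norm_map_le (hφ : ∀ a, 0 ≤ φ (star a * a)) (h1 : φ 1 = 1) (a : A) : ‖φ a‖ ≤ ‖a‖ := by
  have h := norm_map_star_mul_sq_le hφ 1 a
  have h' := re_map_star_mul_self_le hφ a
  rw [star_one, one_mul, one_mul, h1, Complex.one_re, one_mul] at h
  rw [h1, Complex.one_re, mul_one] at h'
  exact le_of_sq_le_sq (h.trans h') (norm_nonneg a)

/-- Cauchy–Schwarz for `a*` and `1 - p`: a projection of almost full mass can be inserted at almost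
no cost. -/
theorem norm_map_mul_projection_sub_le (hφ : ∀ a, 0 ≤ φ (star a * a)) (h1 : φ 1 = 1) {p : A}
    (hp : star p = p) (hpp : p * p = p) (a : A) :
    ‖φ (a * p) - φ a‖ ≤ Real.sqrt ((φ (a * star a)).re * (1 - (φ p).re)) := by
  have h := norm_map_star_mul_sq_le hφ (star a) (1 - p)
  have e : star (1 - p) * (1 - p) = 1 - p := by
    rw [star_sub, star_one, hp, mul_sub, mul_one, sub_mul, one_mul, hpp, sub_self, sub_zero]
  rw [star_star, e, mul_sub, mul_one, map_sub, map_sub, h1, Complex.sub_re, Complex.one_re] at h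
  rw [norm_sub_rev]
  exact Real.le_sqrt_of_sq_le h

end PositiveFunctional

/-! ### The Toeplitz algebra -/


instance {n : ℕ} (Θ : Matrix (Fin n) (Fin n) ℝ) :
    IsClosed (toeplitz Θ : Set (Ell2 (Fin n → ℕ) →L[ℂ] Ell2 (Fin n → ℕ))) :=
  StarSubalgebra.isClosed_topologicalClosure _

/-! Shortcuts for instance search. -/

local instance {n : ℕ} (Θ : Matrix (Fin n) (Fin n) ℝ) : Ring (toeplitz Θ) :=
  inferInstance
local instance {n : ℕ} (Θ : Matrix (Fin n) (Fin n) ℝ) : NormedRing (toeplitz Θ) :=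
  inferInstance
local instance {n : ℕ} (Θ : Matrix (Fin n) (Fin n) ℝ) : StarRing (toeplitz Θ) :=
  inferInstance
local instance {n : ℕ} (Θ : Matrix (Fin n) (Fin n) ℝ) : StarMul (toeplitz Θ) :=
  inferInstance
local instance {n : ℕ} (Θ : Matrix (Fin n) (Fin n) ℝ) : StarModule ℂ (toeplitz Θ) :=
  inferInstance
local instance {n : ℕ} (Θ : Matrix (Fin n) (Fin n) ℝ) : NormedAlgebra ℂ (toeplitz Θ) :=
  inferInstance
local instance {n : ℕ} (Θ : Matrix (Fin n) (Fin n) ℝ) : Semigroup (toeplitz Θ) :=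
  inferInstance
local instance {n : ℕ} (Θ : Matrix (Fin n) (Fin n) ℝ) : MulOneClass (toeplitz Θ) :=
  inferInstance
local instance {n : ℕ} (Θ : Matrix (Fin n) (Fin n) ℝ) : MulZeroClass (toeplitz Θ) :=
  inferInstance
local instance {n : ℕ} (Θ : Matrix (Fin n) (Fin n) ℝ) : AddCommGroup (toeplitz Θ) :=
  inferInstance
local instance {n : ℕ} (Θ : Matrix (Fin n) (Fin n) ℝ) : AddCommMonoid (toeplitz Θ) :=
  inferInstance
local instance {n : ℕ} (Θ : Matrix (Fin n) (Fin n) ℝ) : Module ℂ (toeplitz Θ) :=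
  inferInstance
local instance {n : ℕ} (Θ : Matrix (Fin n) (Fin n) ℝ) : SMul ℂ (toeplitz Θ) :=
  inferInstance
local instance {n : ℕ} (Θ : Matrix (Fin n) (Fin n) ℝ) : IsScalarTower ℂ (toeplitz Θ) (toeplitz Θ) :=
  inferInstance
local instance {n : ℕ} (Θ : Matrix (Fin n) (Fin n) ℝ) : SMulCommClass ℂ (toeplitz Θ) (toeplitz Θ) :=
  inferInstance
local instance {n : ℕ} (Θ : Matrix (Fin n) (Fin n) ℝ) : TopologicalSpace (toeplitz Θ) :=
  inferInstance

theorem toeplitz_ext {n : ℕ} {Θ : Matrix (Fin n) (Fin n) ℝ} {X Y : toeplitz Θ}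
    (h : ∀ q, (X : Ell2 (Fin n → ℕ) →L[ℂ] Ell2 (Fin n → ℕ)) (delta q) =
      (Y : Ell2 (Fin n → ℕ) →L[ℂ] Ell2 (Fin n → ℕ)) (delta q)) : X = Y :=
  Subtype.ext (op_ext h)

theorem coe_mul_delta {n : ℕ} {Θ : Matrix (Fin n) (Fin n) ℝ} (X Y : toeplitz Θ)
    (v : Ell2 (Fin n → ℕ)) :
    ((X * Y : toeplitz Θ) : Ell2 (Fin n → ℕ) →L[ℂ] Ell2 (Fin n → ℕ)) v =
      (X : Ell2 (Fin n → ℕ) →L[ℂ] Ell2 (Fin n → ℕ))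
        ((Y : Ell2 (Fin n → ℕ) →L[ℂ] Ell2 (Fin n → ℕ)) v) := rfl

theorem gen_delta {n : ℕ} (Θ : Matrix (Fin n) (Fin n) ℝ) (p q : Fin n → ℕ) :
    (gen Θ p : Ell2 (Fin n → ℕ) →L[ℂ] Ell2 (Fin n → ℕ)) (delta q) =
      (sigma Θ p q : ℂ) • delta (p + q) := L_delta Θ p q

theorem gen_zero {n : ℕ} (Θ : Matrix (Fin n) (Fin n) ℝ) : gen Θ 0 = 1 :=
  Subtype.ext (L_zero Θ)

theorem star_gen_mul_gen_self {n : ℕ} (Θ : Matrix (Fin n) (Fin n) ℝ) (p : Fin n → ℕ) :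
    star (gen Θ p) * gen Θ p = 1 :=
  Subtype.ext ((ContinuousLinearMap.norm_map_iff_adjoint_comp_self _).mp fun x =>
    LinearIsometry.norm_map _ x)

theorem norm_gen_le {n : ℕ} (Θ : Matrix (Fin n) (Fin n) ℝ) (p : Fin n → ℕ) : ‖gen Θ p‖ ≤ 1 :=
  LinearIsometry.norm_toContinuousLinearMap_le _

theorem pairing_add_left {n : ℕ} (p q : Fin n → ℕ) (r : Fin n → ℝ) :
    pairing (p + q) r = pairing p r + pairing q r := by
  simp [pairing, add_mul, Finset.sum_add_distrib]

theorem pairing_add_right {n : ℕ} (p : Fin n → ℕ) (r s : Fin n → ℝ) :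
    pairing p (r + s) = pairing p r + pairing p s := by
  simp [pairing, mul_add, Finset.sum_add_distrib]

theorem sigma_add_left {n : ℕ} (Θ : Matrix (Fin n) (Fin n) ℝ) (p q s : Fin n → ℕ) :
    sigma Θ (p + q) s = sigma Θ p s * sigma Θ q s := by
  rw [sigma, sigma, sigma, ← Circle.exp_add, pairing_add_left]
  congr 1; ring

theorem sigma_add_right {n : ℕ} (Θ : Matrix (Fin n) (Fin n) ℝ) (p q s : Fin n → ℕ) :
    sigma Θ p (q + s) = sigma Θ p q * sigma Θ p s := by
  have h : (fun j => (((q + s) j : ℕ) : ℝ)) = (fun j => (q j : ℝ)) + fun j => (s j : ℝ) := by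
    ext j; simp
  rw [sigma, sigma, sigma, ← Circle.exp_add, h, Matrix.mulVec_add, pairing_add_right]
  congr 1; ring

theorem gen_mul_gen {n : ℕ} (Θ : Matrix (Fin n) (Fin n) ℝ) (p q : Fin n → ℕ) :
    gen Θ p * gen Θ q = (sigma Θ p q : ℂ) • gen Θ (p + q) := by
  refine toeplitz_ext fun s => ?_
  change L Θ p (L Θ q (delta s)) = (sigma Θ p q : ℂ) • L Θ (p + q) (delta s)
  rw [L_delta, map_smul, L_delta, L_delta, smul_smul, smul_smul, sigma_add_right, sigma_add_left,
    add_assoc, Circle.coe_mul, Circle.coe_mul]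
  congr 1; ring

theorem gen_add {n : ℕ} (Θ : Matrix (Fin n) (Fin n) ℝ) (p q : Fin n → ℕ) :
    gen Θ (p + q) = (((sigma Θ p q)⁻¹ : Circle) : ℂ) • (gen Θ p * gen Θ q) := by
  rw [gen_mul_gen, smul_smul, ← Circle.coe_mul]
  simp

theorem gen_mul_gen_comm {n : ℕ} (Θ : Matrix (Fin n) (Fin n) ℝ) (p q : Fin n → ℕ) :
    ∃ c : Circle, gen Θ p * gen Θ q = (c : ℂ) • (gen Θ q * gen Θ p) := by
  refine ⟨sigma Θ p q * (sigma Θ q p)⁻¹, ?_⟩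
  rw [gen_mul_gen, gen_mul_gen, smul_smul, ← Circle.coe_mul, add_comm q p]
  simp

theorem rangeProj_gen_delta {n : ℕ} (Θ : Matrix (Fin n) (Fin n) ℝ) (p q : Fin n → ℕ)
    [Decidable (p ≤ q)] :
    ((gen Θ p * star (gen Θ p) : toeplitz Θ) : Ell2 (Fin n → ℕ) →L[ℂ] Ell2 (Fin n → ℕ)) (delta q) =
      if p ≤ q then delta q else 0 := rangeProj_delta Θ p q

theorem star_gen_eq {n : ℕ} (Θ : Matrix (Fin n) (Fin n) ℝ) (p : Fin n → ℕ) :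
    star (gen Θ p) = star (gen Θ p) * (gen Θ p * star (gen Θ p)) := by
  rw [← mul_assoc, star_gen_mul_gen_self, one_mul]

theorem star_gen_delta_eq_zero {n : ℕ} (Θ : Matrix (Fin n) (Fin n) ℝ) {p q : Fin n → ℕ}
    (h : ¬p ≤ q) :
    ((star (gen Θ p) : toeplitz Θ) : Ell2 (Fin n → ℕ) →L[ℂ] Ell2 (Fin n → ℕ)) (delta q) = 0 := by
  classical
  rw [star_gen_eq, coe_mul_delta, rangeProj_gen_delta, if_neg h, map_zero]

/-! Generators with disjoint supports. -/

/-- The range projection is diagonal, cutting down to `p ≤ q`, and translation by `u` does not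
change the coordinates in the support of `p`. -/
theorem gen_commute_rangeProj {n : ℕ} (Θ : Matrix (Fin n) (Fin n) ℝ) {p u : Fin n → ℕ}
    (h : ∀ j, p j = 0 ∨ u j = 0) :
    gen Θ p * star (gen Θ p) * gen Θ u = gen Θ u * (gen Θ p * star (gen Θ p)) := by
  classical
  refine toeplitz_ext fun q => ?_
  have e : p ≤ u + q ↔ p ≤ q := by
    refine forall_congr' fun j => ?_
    rw [Pi.add_apply]
    rcases h j with h | h <;> simp [h]
  rw [coe_mul_delta, coe_mul_delta (gen Θ u), gen_delta, map_smul, rangeProj_gen_delta,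
    rangeProj_gen_delta]
  simp only [e]
  split_ifs
  · rw [gen_delta]
  · simp

/-- The point is that one phase `c` serves both relations; this makes the phases cancel in
`term_tail_comm`. -/
theorem star_gen_mul_gen_comm {n : ℕ} (Θ : Matrix (Fin n) (Fin n) ℝ) {p u : Fin n → ℕ}
    (h : ∀ j, p j = 0 ∨ u j = 0) :
    ∃ c : Circle, star (gen Θ p) * gen Θ u = (c : ℂ) • (gen Θ u * star (gen Θ p)) ∧
      gen Θ u * gen Θ p = (c : ℂ) • (gen Θ p * gen Θ u) := by
  obtain ⟨c, hc⟩ := gen_mul_gen_comm Θ u p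
  refine ⟨c, ?_, hc⟩
  calc star (gen Θ p) * gen Θ u = star (gen Θ p) * (gen Θ p * star (gen Θ p) * gen Θ u) := by
        rw [← mul_assoc, ← star_gen_eq]
    _ = star (gen Θ p) * (gen Θ u * gen Θ p) * star (gen Θ p) := by
        rw [gen_commute_rangeProj Θ h]; simp only [mul_assoc]
    _ = (c : ℂ) • (star (gen Θ p) * gen Θ p * (gen Θ u * star (gen Θ p))) := by
        rw [hc]; simp only [mul_smul_comm, smul_mul_assoc, mul_assoc]
    _ = _ := by rw [star_gen_mul_gen_self, one_mul]

/-! Density of the span of the monomials. -/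

/-- The words in the `L_p` and `L_p*` span a dense subspace. A general monoid `S` is allowed so that
`kmsWeightVectors` can be used for it. -/
theorem toeplitz_span_induction {n : ℕ} {Θ : Matrix (Fin n) (Fin n) ℝ}
    (S : Submonoid (toeplitz Θ)) (hL : ∀ p, gen Θ p ∈ S) (hL' : ∀ p, star (gen Θ p) ∈ S)
    (V : Submodule ℂ (toeplitz Θ)) (hV : IsClosed (V : Set (toeplitz Θ))) (hS : ∀ x ∈ S, x ∈ V)
    (x : toeplitz Θ) : x ∈ V := by
  let ι : toeplitz Θ →ₗ[ℂ] (Ell2 (Fin n → ℕ) →L[ℂ] Ell2 (Fin n → ℕ)) :=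
    (toeplitz Θ).subtype.toAlgHom.toLinearMap
  let S' := S.map (toeplitz Θ).subtype
  have h1 : Submonoid.closure (Set.range (L Θ) ∪ star (Set.range (L Θ))) ≤ S' := by
    rw [Submonoid.closure_le]
    rintro y (⟨p, rfl⟩ | ⟨p, hp⟩)
    · exact ⟨gen Θ p, hL p, rfl⟩
    · refine ⟨star (gen Θ p), hL' p, ?_⟩
      change star (L Θ p) = y
      rw [hp, star_star]
  have h2 : ((StarAlgebra.adjoin ℂ (Set.range (L Θ)) : StarSubalgebra ℂ _) : Set _) ⊆
      (V.map ι : Set (Ell2 (Fin n → ℕ) →L[ℂ] Ell2 (Fin n → ℕ))) := by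
    intro y hy
    have hy' : y ∈ Subalgebra.toSubmodule
      (StarAlgebra.adjoin ℂ (Set.range (L Θ))).toSubalgebra := hy
    rw [StarAlgebra.adjoin_eq_span] at hy'
    refine Submodule.span_le.mpr ?_ hy'
    intro z hz
    obtain ⟨w, hw, rfl⟩ := h1 hz
    exact ⟨w, hS w hw, rfl⟩
  -- Closure inside the algebra is tested by closure of the image in `B(ℓ²)`.
  rw [← SetLike.mem_coe, ← hV.closure_eq, closure_subtype]
  exact closure_mono h2 x.2

/-! ### The weights -/

theorem pairing_incl {k d : ℕ} (l : Fin k → ℕ) (r : Fin (k + d) → ℝ) :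
    pairing (incl d l) r = ∑ j : Fin k, (l j : ℝ) * r (Fin.castAdd d j) := by
  simp [pairing, incl, Fin.sum_univ_add]

theorem weight_eq_prod {k d : ℕ} (r : Fin (k + d) → ℝ) (β : ℝ) (l : Fin k → ℕ) :
    weight (d := d) r β l = ∏ j : Fin k, Real.exp (-(β * r (Fin.castAdd d j))) ^ l j := by
  rw [weight, pairing_incl, Finset.mul_sum, ← Finset.sum_neg_distrib, Real.exp_sum]
  refine Finset.prod_congr rfl fun j _ => ?_
  rw [← Real.exp_nat_mul]
  congr 1; ring

theorem hasSum_prod_pow {k : ℕ} (x : Fin k → ℝ) (h0 : ∀ j, 0 ≤ x j) (h1 : ∀ j, x j < 1) :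
    HasSum (fun l : Fin k → ℕ => ∏ j, x j ^ l j) (∏ j, (1 - x j)⁻¹) := by
  induction k with
  | zero => simp [hasSum_unique]
  | succ k ih =>
    have ha := hasSum_geometric_of_lt_one (h0 0) (h1 0)
    have hb := ih (fun j => x j.succ) (fun j => h0 _) (fun j => h1 _)
    have hs : Summable fun y : ℕ × (Fin k → ℕ) => x 0 ^ y.1 * ∏ j : Fin k, x j.succ ^ y.2 j :=
      Summable.mul_of_nonneg (f := fun i : ℕ => x 0 ^ i)
        (g := fun l : Fin k → ℕ => ∏ j : Fin k, x j.succ ^ l j) ha.summable hb.summable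
        (Pi.le_def.mpr fun i => pow_nonneg (h0 0) i)
        (Pi.le_def.mpr fun l => Finset.prod_nonneg fun j _ => pow_nonneg (h0 _) _)
    have hab := HasSum.mul (f := fun i : ℕ => x 0 ^ i)
        (g := fun l : Fin k → ℕ => ∏ j : Fin k, x j.succ ^ l j) ha hb hs
    rw [Fin.prod_univ_succ, ← (Fin.consEquiv fun _ => ℕ).hasSum_iff]
    have e : (fun l : Fin (k + 1) → ℕ => ∏ j, x j ^ l j) ∘ (Fin.consEquiv fun _ => ℕ) =
        fun y => x 0 ^ y.1 * ∏ j : Fin k, x j.succ ^ y.2 j := by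
      funext y
      simp [Fin.consEquiv, Fin.prod_univ_succ]
    rw [e]
    exact hab

theorem hasSum_weight {k d : ℕ} {r : Fin (k + d) → ℝ} (hr : ∀ j : Fin k, 0 < r (Fin.castAdd d j))
    {β : ℝ} (hβ : 0 < β) :
    HasSum (fun l : Fin k → ℕ => weight (d := d) r β l)
      (∏ j : Fin k, (1 - Real.exp (-(β * r (Fin.castAdd d j))))⁻¹) := by
  simp_rw [weight_eq_prod]
  refine hasSum_prod_pow _ (fun j => (Real.exp_pos _).le) fun j => ?_
  rw [Real.exp_lt_one_iff]
  have := mul_pos hβ (hr j)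
  linarith

theorem weight_pos {k d : ℕ} (r : Fin (k + d) → ℝ) (β : ℝ) (l : Fin k → ℕ) :
    0 < weight (d := d) r β l := Real.exp_pos _

theorem incl_add {k : ℕ} (d : ℕ) (a l : Fin k → ℕ) : incl d (a + l) = incl d a + incl d l := by
  ext j
  refine Fin.addCases (fun i => ?_) (fun i => ?_) j <;> simp [incl]

theorem incl_zero {k : ℕ} (d : ℕ) : incl d (0 : Fin k → ℕ) = 0 := by
  ext j
  refine Fin.addCases (fun i => ?_) (fun i => ?_) j <;> simp [incl]

theorem weight_add {k d : ℕ} (r : Fin (k + d) → ℝ) (β : ℝ) (a l : Fin k → ℕ) :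
    weight (d := d) r β (a + l) = weight (d := d) r β a * weight (d := d) r β l := by
  rw [weight, weight, weight, ← Real.exp_add, incl_add, pairing_add_left]
  congr 1; ring

theorem weight_zero {k d : ℕ} (r : Fin (k + d) → ℝ) (β : ℝ) :
    weight (d := d) r β (0 : Fin k → ℕ) = 1 := by
  simp [weight, incl_zero, pairing]

theorem Z_pos {k d : ℕ} {r : Fin (k + d) → ℝ} (hr : ∀ j : Fin k, 0 < r (Fin.castAdd d j))
    {β : ℝ} (hβ : 0 < β) : 0 < Z (d := d) r β :=
  (hasSum_weight hr hβ).summable.tsum_pos (fun l => (weight_pos r β l).le) 0 (weight_pos r β 0)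

/-! ### The projection `Q` and the corner -/

section Corner

variable {k d : ℕ} (Θ : Matrix (Fin (k + d)) (Fin (k + d)) ℝ)

theorem Q_mul_Q : Q Θ * Q Θ = Q Θ := (Q_isStarProjection Θ).isIdempotentElem

theorem star_Q : star (Q Θ) = Q Θ := (Q_isStarProjection Θ).isSelfAdjoint.star_eq

/-- `L_l Q` maps into the span of basis vectors whose first `k` coordinates are exactly `l`, and
`L_a*` kills those when `a ≤ l` fails. -/
theorem star_gen_mul_gen_mul_Q {a l : Fin k → ℕ} (h : ¬a ≤ l) :
    star (gen Θ (incl d a)) * (gen Θ (incl d l) * Q Θ) = 0 := by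
  refine toeplitz_ext fun q => ?_
  rw [coe_mul_delta, coe_mul_delta, Q_delta]
  split_ifs with hq
  · rw [gen_delta, map_smul, star_gen_delta_eq_zero, smul_zero]
    · rfl
    · refine fun h' => h fun j => ?_
      have := h' (Fin.castAdd d j)
      simpa [incl, hq j] using this
  · simp

theorem Q_mul_star_gen_mul_gen {a l : Fin k → ℕ} (h : ¬a ≤ l) :
    Q Θ * star (gen Θ (incl d l)) * gen Θ (incl d a) = 0 := by
  have := congrArg star (star_gen_mul_gen_mul_Q Θ h)
  simpa [star_Q, mul_assoc] using this

/-- For `l ≠ m` at least one of `l ≤ m`, `m ≤ l` fails, and each failure kills the product from one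
side. -/
theorem Q_mul_star_gen_mul_gen_mul_Q (l m : Fin k → ℕ) :
    Q Θ * star (gen Θ (incl d l)) * (gen Θ (incl d m) * Q Θ) = if l = m then Q Θ else 0 := by
  split_ifs with h
  · subst h
    rw [mul_assoc, ← mul_assoc (star _), star_gen_mul_gen_self, one_mul, Q_mul_Q]
  · by_cases h1 : l ≤ m
    · have h2 : ¬m ≤ l := fun h2 => h (le_antisymm h1 h2)
      rw [← mul_assoc, Q_mul_star_gen_mul_gen Θ h2, zero_mul]
    · rw [mul_assoc, star_gen_mul_gen_mul_Q Θ h1, mul_zero]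

theorem Q_mul_gen_incl {m : Fin k → ℕ} (h : m ≠ 0) : Q Θ * gen Θ (incl d m) = 0 := by
  have h' : ¬m ≤ 0 := fun h' => h (le_antisymm h' zero_le)
  simpa [incl_zero, gen_zero] using Q_mul_star_gen_mul_gen Θ h'

theorem gen_mul_Q_comm {u : Fin (k + d) → ℕ} (hu : ∀ j : Fin k, u (Fin.castAdd d j) = 0) :
    gen Θ u * Q Θ = Q Θ * gen Θ u := by
  refine toeplitz_ext fun q => ?_
  rw [coe_mul_delta, coe_mul_delta, Q_delta, gen_delta, map_smul, Q_delta]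
  simp only [Pi.add_apply, hu, zero_add]
  split_ifs
  · rw [gen_delta]
  · simp

theorem exists_eq_incl_add (p : Fin (k + d) → ℕ) : ∃ (a : Fin k → ℕ) (u : Fin (k + d) → ℕ),
    (∀ j : Fin k, u (Fin.castAdd d j) = 0) ∧ p = incl d a + u := by
  refine ⟨fun j => p (Fin.castAdd d j), Fin.append 0 fun j => p (Fin.natAdd k j), by simp, ?_⟩
  ext j
  refine Fin.addCases (fun i => ?_) (fun i => ?_) j <;> simp [incl]

end Corner

/-! ### Functionals on a corner -/

section CornerFunctional

/-! ### Compression to a corner and the induced maps on functionals -/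

section Def

variable {A : Type} [NormedRing A] [StarRing A] [NormedAlgebra ℂ A] [StarModule ℂ A]
  {e : A} (he : IsStarProjection e)

/-- The compression `a ↦ e a e` onto the corner. -/
def cornerMap : A →ₗ[ℂ] corner e he where
  toFun a := ⟨e * a * e, a, rfl⟩
  map_add' a b := Subtype.ext (by
    change e * (a + b) * e = e * a * e + e * b * e
    rw [mul_add, add_mul])
  map_smul' c a := Subtype.ext (by
    change e * (c • a) * e = c • (e * a * e)
    rw [mul_smul_comm, smul_mul_assoc])

theorem cornerMap_coe (x : corner e he) : cornerMap he (x : A) = x := by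
  obtain ⟨_, a, rfl⟩ := x
  refine Subtype.ext ?_
  change e * (e * a * e) * e = e * a * e
  rw [mul_assoc, mul_assoc, he.isIdempotentElem.eq, ← mul_assoc, ← mul_assoc,
    he.isIdempotentElem.eq]

theorem cornerMap_mul_cornerMap (a b : A) :
    cornerMap he a * cornerMap he b = cornerMap he (a * e * b) := by
  refine Subtype.ext ?_
  change e * a * e * (e * b * e) = e * (a * e * b) * e
  simp only [mul_assoc]
  rw [← mul_assoc e e, he.isIdempotentElem.eq]

theorem cornerMap_mul_left (a : A) : cornerMap he (e * a) = cornerMap he a := by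
  refine Subtype.ext ?_
  change e * (e * a) * e = e * a * e
  rw [← mul_assoc, he.isIdempotentElem.eq]

theorem cornerMap_mul_right (a : A) : cornerMap he (a * e) = cornerMap he a := by
  refine Subtype.ext ?_
  change e * (a * e) * e = e * a * e
  rw [mul_assoc, mul_assoc, he.isIdempotentElem.eq, mul_assoc]

variable {he}

/-- The functional `a ↦ ω(e a e)`. -/
def inflate (ω : WeakDual ℂ (corner e he)) : A →ₗ[ℂ] ℂ where
  toFun a := ω (cornerMap he a)
  map_add' a b := by rw [map_add, map_add]
  map_smul' c a := by rw [map_smul, map_smul, RingHom.id_apply]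

theorem inflate_apply (ω : WeakDual ℂ (corner e he)) (a : A) :
    inflate ω a = ω (cornerMap he a) := rfl

theorem inflate_coe (ω : WeakDual ℂ (corner e he)) (x : corner e he) :
    inflate ω (x : A) = ω x := by
  rw [inflate_apply, cornerMap_coe]

theorem inflate_mul_left (ω : WeakDual ℂ (corner e he)) (a : A) :
    inflate ω (e * a) = inflate ω a := by
  rw [inflate_apply, cornerMap_mul_left, inflate_apply]

theorem inflate_mul_right (ω : WeakDual ℂ (corner e he)) (a : A) :
    inflate ω (a * e) = inflate ω a := by
  rw [inflate_apply, cornerMap_mul_right, inflate_apply]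

theorem inflate_mul_mul_comm {ω : WeakDual ℂ (corner e he)}
    (hω : ∀ x y : corner e he, ω (x * y) = ω (y * x)) (a b : A) :
    inflate ω (a * e * b) = inflate ω (b * e * a) := by
  rw [inflate_apply, inflate_apply, ← cornerMap_mul_cornerMap, ← cornerMap_mul_cornerMap, hω]

variable (he) in
/-- The restriction of a functional to the corner, rescaled by `c`. -/
def restrictCorner (c : ℂ) (φ : WeakDual ℂ A) : WeakDual ℂ (corner e he) :=
  StrongDual.toWeakDual
    { toFun := fun x => c * φ (x : A)
      map_add' := fun x y => by
        change c * φ ((x : A) + (y : A)) = _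
        rw [map_add, mul_add]
      map_smul' := fun z x => by
        change c * φ (z • (x : A)) = _
        rw [map_smul, RingHom.id_apply, smul_eq_mul, smul_eq_mul, mul_left_comm]
      cont := continuous_const.mul ((map_continuous φ).comp continuous_subtype_val) }

theorem inflate_restrictCorner (c : ℂ) (φ : WeakDual ℂ A) (a : A) :
    inflate (restrictCorner he c φ) a = c * φ (e * a * e) := rfl

theorem restrictCorner_mem_tracialStates {c : ℝ} (hc : 0 ≤ c) {φ : WeakDual ℂ A}
    (hφ : ∀ a, 0 ≤ φ (star a * a)) (hφe : (c : ℂ) * φ e = 1)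
    (hφt : ∀ x y : corner e he, φ ((x : A) * (y : A)) = φ ((y : A) * (x : A))) :
    restrictCorner he (c : ℂ) φ ∈ tracialStates (corner e he) (cornerMap he 1) := by
  refine ⟨⟨fun x => ?_, ?_⟩, fun x y => ?_⟩
  · exact mul_nonneg (Complex.zero_le_real.mpr hc) (hφ x)
  · have : e * 1 * e = e := by rw [mul_one, he.isIdempotentElem.eq]
    change (c : ℂ) * φ (e * 1 * e) = 1
    rw [this, hφe]
  · change (c : ℂ) * φ ((x : A) * (y : A)) = c * φ ((y : A) * (x : A))
    rw [hφt]

end Def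

variable {A : Type} [CStarAlgebra A] {e : A} {he : IsStarProjection e}

variable (he) in
-- The element `a e` need not lie in the corner, so it is replaced by its absolute value `s`, which
-- does. Hence positivity on the corner passes to the inflated functional.
theorem exists_cornerMap_star_mul_self (a : A) :
    ∃ x : corner e he, cornerMap he (star a * a) = star x * x := by
  obtain ⟨s, hs, hss⟩ := exists_selfAdjoint_sqrt (a * e)
  have hee := he.isIdempotentElem.eq
  have hse := he.isSelfAdjoint.star_eq
  -- `s² = (a e)* (a e)` annihilates `1 - e`; the C*-identity passes this to `s`.
  have h0 : s * (1 - e) = 0 := by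
    have h : s * s * (1 - e) = 0 := by
      rw [hss, mul_assoc, mul_assoc, mul_sub, mul_one, hee, sub_self, mul_zero, mul_zero]
    rw [← CStarRing.star_mul_self_eq_zero_iff, star_mul, hs, mul_assoc, ← mul_assoc s s, h,
      mul_zero]
  have h1 : s * e = s := by
    rw [mul_sub, mul_one, sub_eq_zero] at h0
    exact h0.symm
  have h2 : e * s = s := by
    have := congrArg star h1
    rwa [star_mul, hse, hs] at this
  refine ⟨cornerMap he s, Subtype.ext ?_⟩
  change e * (star a * a) * e = star (e * s * e) * (e * s * e)
  rw [h2, h1, hs, hss, star_mul, hse]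
  simp only [mul_assoc]

theorem inflate_nonneg {ω : WeakDual ℂ (corner e he)} (hω : ∀ x, 0 ≤ ω (star x * x)) (a : A) :
    0 ≤ inflate ω (star a * a) := by
  obtain ⟨x, hx⟩ := exists_cornerMap_star_mul_self he a
  rw [inflate_apply, hx]
  exact hω x

end CornerFunctional

/-! ### Inflated corner traces as states of the Toeplitz algebra -/

section

variable {k d : ℕ} {Θ : Matrix (Fin (k + d)) (Fin (k + d)) ℝ}

theorem cornerTraces_nonneg {ω : WeakDual ℂ (cornerQ Θ)} (hω : ω ∈ cornerTraces Θ)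
    (X : toeplitz Θ) : 0 ≤ inflate ω (star X * X) :=
  inflate_nonneg hω.1.1 X

theorem inflate_one {ω : WeakDual ℂ (cornerQ Θ)} (hω : ω ∈ cornerTraces Θ) :
    inflate ω 1 = 1 := hω.1.2

theorem norm_inflate_le {ω : WeakDual ℂ (cornerQ Θ)} (hω : ω ∈ cornerTraces Θ)
    (X : toeplitz Θ) : ‖inflate ω X‖ ≤ ‖X‖ :=
  norm_map_le (cornerTraces_nonneg hω) (inflate_one hω) X

theorem inflate_mul_Q_mul_comm {ω : WeakDual ℂ (cornerQ Θ)} (hω : ω ∈ cornerTraces Θ)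
    (X Y : toeplitz Θ) : inflate ω (X * Q Θ * Y) = inflate ω (Y * Q Θ * X) :=
  inflate_mul_mul_comm hω.2 X Y

theorem term_eq (r : Fin (k + d) → ℝ) (β : ℝ) (ω : WeakDual ℂ (cornerQ Θ)) (X : toeplitz Θ)
    (l : Fin k → ℕ) : term Θ r β ω X l = (weight (d := d) r β l : ℂ) *
      inflate ω (star (gen Θ (incl d l)) * X * gen Θ (incl d l)) := rfl

end

/-! ### The functional `T_β(ω)` -/

section Average

theorem norm_star_gen_le {n : ℕ} (Θ : Matrix (Fin n) (Fin n) ℝ) (p : Fin n → ℕ) :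
    ‖star (gen Θ p)‖ ≤ 1 :=
  (norm_star (L Θ p)).trans_le (norm_gen_le Θ p)

variable {k d : ℕ} {Θ : Matrix (Fin (k + d)) (Fin (k + d)) ℝ} {r : Fin (k + d) → ℝ} {β : ℝ}
  {ω : WeakDual ℂ (cornerQ Θ)}

theorem norm_term_le (hω : ω ∈ cornerTraces Θ) (X : toeplitz Θ) (l : Fin k → ℕ) :
    ‖term Θ r β ω X l‖ ≤ weight (d := d) r β l * ‖X‖ := by
  rw [term_eq, norm_mul, Complex.norm_real, Real.norm_eq_abs, abs_of_pos (weight_pos r β l)]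
  refine mul_le_mul_of_nonneg_left ((norm_inflate_le hω _).trans ?_) (weight_pos r β l).le
  have h := norm_gen_le Θ (incl d l)
  have h' := norm_star_gen_le Θ (incl d l)
  calc ‖star (gen Θ (incl d l)) * X * gen Θ (incl d l)‖
      ≤ ‖star (gen Θ (incl d l))‖ * ‖X‖ * ‖gen Θ (incl d l)‖ :=
        (norm_mul_le _ _).trans (mul_le_mul_of_nonneg_right (norm_mul_le _ _) (norm_nonneg _))
    _ ≤ 1 * ‖X‖ * 1 := by gcongr
    _ = ‖X‖ := by ring

theorem summable_term (hr : ∀ j : Fin k, 0 < r (Fin.castAdd d j)) (hβ : 0 < β)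
    (hω : ω ∈ cornerTraces Θ) (X : toeplitz Θ) :
    Summable fun l : Fin k → ℕ => term Θ r β ω X l :=
  .of_norm_bounded ((hasSum_weight hr hβ).summable.mul_right ‖X‖) fun l => norm_term_le hω X l

theorem norm_Tfun_le (hr : ∀ j : Fin k, 0 < r (Fin.castAdd d j)) (hβ : 0 < β)
    (hω : ω ∈ cornerTraces Θ) (X : toeplitz Θ) : ‖Tfun Θ r β ω X‖ ≤ 1 * ‖X‖ := by
  have hZ := Z_pos hr hβ
  have h := tsum_of_norm_bounded (((hasSum_weight hr hβ).summable.hasSum).mul_right ‖X‖)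
    fun l => norm_term_le (r := r) (β := β) hω X l
  rw [Tfun, norm_mul, norm_inv, Complex.norm_real, Real.norm_eq_abs, abs_of_pos hZ, one_mul]
  rwa [inv_mul_le_iff₀ hZ]

/-- `T_β(ω)` as a continuous functional. -/
def Tmap (hr : ∀ j : Fin k, 0 < r (Fin.castAdd d j)) (hβ : 0 < β) (hω : ω ∈ cornerTraces Θ) :
    WeakDual ℂ (toeplitz Θ) :=
  StrongDual.toWeakDual (LinearMap.mkContinuous
    { toFun := Tfun Θ r β ω
      map_add' := fun X Y => by
        rw [Tfun, Tfun, Tfun, ← mul_add,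
          ← (summable_term hr hβ hω X).tsum_add (summable_term hr hβ hω Y)]
        simp only [term_eq, mul_add, add_mul, map_add]
      map_smul' := fun c X => by
        have h : ∀ l, term Θ r β ω (c • X) l = c * term Θ r β ω X l := fun l => by
          rw [term_eq, term_eq, mul_smul_comm, smul_mul_assoc, map_smul, smul_eq_mul,
            mul_left_comm]
        simp only [Tfun, h, tsum_mul_left, RingHom.id_apply, smul_eq_mul]
        ring } 1 (norm_Tfun_le hr hβ hω))

theorem Tfun_nonneg (hr : ∀ j : Fin k, 0 < r (Fin.castAdd d j)) (hβ : 0 < β)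
    (hω : ω ∈ cornerTraces Θ) (X : toeplitz Θ) : 0 ≤ Tfun Θ r β ω (star X * X) := by
  rw [Tfun, ← Complex.ofReal_inv]
  refine mul_nonneg (Complex.zero_le_real.mpr (inv_nonneg.mpr (Z_pos hr hβ).le))
    (tsum_nonneg fun l => ?_)
  rw [term_eq]
  refine mul_nonneg (Complex.zero_le_real.mpr (weight_pos r β l).le) ?_
  have h := cornerTraces_nonneg hω (X * gen Θ (incl d l))
  rw [star_mul] at h
  simpa only [mul_assoc] using h

theorem Tfun_one (hr : ∀ j : Fin k, 0 < r (Fin.castAdd d j)) (hβ : 0 < β)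
    (hω : ω ∈ cornerTraces Θ) : Tfun Θ r β ω 1 = 1 := by
  have h : ∀ l : Fin k → ℕ, term Θ r β ω 1 l = (weight (d := d) r β l : ℂ) := fun l => by
    rw [term_eq, mul_one, star_gen_mul_gen_self, inflate_one hω, mul_one]
  rw [Tfun, tsum_congr h, ← Complex.ofReal_tsum]
  exact inv_mul_cancel₀ (Complex.ofReal_ne_zero.mpr (Z_pos hr hβ).ne')

theorem Tmap_mem_states (hr : ∀ j : Fin k, 0 < r (Fin.castAdd d j)) (hβ : 0 < β)
    (hω : ω ∈ cornerTraces Θ) : Tmap hr hβ hω ∈ states (toeplitz Θ) 1 :=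
  ⟨fun X => Tfun_nonneg hr hβ hω X, Tfun_one hr hβ hω⟩

/-! `T_β(ω)` satisfies the KMS condition on the generators. -/

/-- The trace property only swaps factors separated by a `Q`; since `L_u` commutes with `Q`, one can
be inserted and removed freely. -/
theorem inflate_gen_mul_comm (hω : ω ∈ cornerTraces Θ) {u : Fin (k + d) → ℕ}
    (hu : ∀ j : Fin k, u (Fin.castAdd d j) = 0) (Y : toeplitz Θ) :
    inflate ω (gen Θ u * Y) = inflate ω (Y * gen Θ u) := by
  have h := gen_mul_Q_comm Θ hu
  calc inflate ω (gen Θ u * Y) = inflate ω (gen Θ u * Q Θ * Y) := by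
        rw [h, mul_assoc]
        exact (inflate_mul_left ω _).symm
    _ = inflate ω (Y * Q Θ * gen Θ u) := inflate_mul_Q_mul_comm hω _ _
    _ = inflate ω (Y * gen Θ u) := by
        rw [mul_assoc, ← h, ← mul_assoc]
        exact inflate_mul_right ω _

/-- Pulling `L_u` out past `L_l*` produces a phase, which is absorbed when `L_u` is put back in
front of `L_l` on the other side. -/
theorem term_tail_comm (hω : ω ∈ cornerTraces Θ) {u : Fin (k + d) → ℕ}
    (hu : ∀ j : Fin k, u (Fin.castAdd d j) = 0) (X : toeplitz Θ) (l : Fin k → ℕ) :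
    term Θ r β ω (gen Θ u * X) l = term Θ r β ω (X * gen Θ u) l := by
  have hd : ∀ j, incl d l j = 0 ∨ u j = 0 := fun j => by
    refine Fin.addCases (fun i => Or.inr (hu i)) (fun i => Or.inl ?_) j
    simp [incl]
  obtain ⟨c, h1, h2⟩ := star_gen_mul_gen_comm Θ hd
  rw [term_eq, term_eq]
  congr 1
  calc inflate ω (star (gen Θ (incl d l)) * (gen Θ u * X) * gen Θ (incl d l))
      = c * inflate ω (gen Θ u * (star (gen Θ (incl d l)) * X * gen Θ (incl d l))) := by
        rw [← mul_assoc, h1, smul_mul_assoc, smul_mul_assoc, map_smul, smul_eq_mul]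
        simp only [mul_assoc]
    _ = c * inflate ω (star (gen Θ (incl d l)) * X * (gen Θ (incl d l) * gen Θ u)) := by
        rw [inflate_gen_mul_comm hω hu, mul_assoc _ (gen Θ (incl d l))]
    _ = inflate ω (star (gen Θ (incl d l)) * X * (gen Θ u * gen Θ (incl d l))) := by
        rw [h2, mul_smul_comm, map_smul, smul_eq_mul]
    _ = _ := by simp only [mul_assoc]

theorem term_incl_eq_zero {a l : Fin k → ℕ} (h : ¬a ≤ l) (X : toeplitz Θ) :
    term Θ r β ω (gen Θ (incl d a) * X) l = 0 := by
  have h0 : inflate ω (star (gen Θ (incl d l)) * (gen Θ (incl d a) * X) * gen Θ (incl d l)) =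
      inflate ω (Q Θ * (star (gen Θ (incl d l)) * (gen Θ (incl d a) * X) * gen Θ (incl d l))) :=
    (inflate_mul_left ω _).symm
  have h1 : Q Θ * (star (gen Θ (incl d l)) * (gen Θ (incl d a) * X) * gen Θ (incl d l)) =
      Q Θ * star (gen Θ (incl d l)) * gen Θ (incl d a) * (X * gen Θ (incl d l)) := by
    simp only [mul_assoc]
  rw [term_eq, h0, h1, Q_mul_star_gen_mul_gen Θ h, zero_mul, map_zero, mul_zero]

/-- `L_{a+l}` is a unimodular multiple of `L_a L_l`, so `L_{a+l}* L_a` collapses to `L_l*` by `L_a*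
L_a = 1`, and the two phases cancel. -/
theorem term_incl_add (a l : Fin k → ℕ) (X : toeplitz Θ) :
    term Θ r β ω (gen Θ (incl d a) * X) (a + l) =
      weight (d := d) r β a * term Θ r β ω (X * gen Θ (incl d a)) l := by
  set c := (sigma Θ (incl d a) (incl d l))⁻¹
  have hc : star (c : ℂ) * (c : ℂ) = 1 := by
    rw [Complex.star_def, ← Circle.coe_inv_eq_conj, ← Circle.coe_mul, inv_mul_cancel, Circle.coe_one]
  have h : star (gen Θ (incl d (a + l))) * (gen Θ (incl d a) * X) * gen Θ (incl d (a + l)) =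
      star (gen Θ (incl d l)) * (X * gen Θ (incl d a)) * gen Θ (incl d l) := by
    calc _ = (star (c : ℂ) * (c : ℂ)) • (star (gen Θ (incl d l)) *
          (star (gen Θ (incl d a)) * gen Θ (incl d a)) * (X * gen Θ (incl d a)) *
            gen Θ (incl d l)) := by
          rw [incl_add, gen_add, star_smul, star_mul]
          simp only [smul_mul_assoc, mul_smul_comm, smul_smul, mul_assoc]
          rw [mul_comm (c : ℂ)]
      _ = _ := by rw [hc, one_smul, star_gen_mul_gen_self, mul_one]
  rw [term_eq, term_eq, h, weight_add, Complex.ofReal_mul, mul_assoc]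

theorem Tfun_incl_mul (a : Fin k → ℕ) (X : toeplitz Θ) :
    Tfun Θ r β ω (gen Θ (incl d a) * X) =
      weight (d := d) r β a * Tfun Θ r β ω (X * gen Θ (incl d a)) := by
  -- The summand is supported on the `l` with `a ≤ l`, the range of translation by `a`.
  have h : ∑' l, term Θ r β ω (gen Θ (incl d a) * X) l =
      ∑' l, term Θ r β ω (gen Θ (incl d a) * X) (a + l) := by
    refine ((add_right_injective a).tsum_eq fun l hl => ?_).symm
    by_contra hn
    refine hl (term_incl_eq_zero (fun hal => hn ?_) X)
    obtain ⟨m, rfl⟩ := exists_add_of_le hal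
    exact ⟨m, rfl⟩
  rw [Tfun, Tfun, h]
  simp only [term_incl_add, tsum_mul_left]
  ring

theorem Tfun_gen_mul (hr0 : ∀ j : Fin d, r (Fin.natAdd k j) = 0) (hω : ω ∈ cornerTraces Θ)
    (p : Fin (k + d) → ℕ) (X : toeplitz Θ) :
    Tfun Θ r β ω (gen Θ p * X) = Real.exp (-(β * pairing p r)) * Tfun Θ r β ω (X * gen Θ p) := by
  obtain ⟨a, u, hu, rfl⟩ := exists_eq_incl_add p
  have hur : pairing u r = 0 := by simp [pairing, Fin.sum_univ_add, hu, hr0]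
  have htail : ∀ Y, Tfun Θ r β ω (gen Θ u * Y) = Tfun Θ r β ω (Y * gen Θ u) := fun Y => by
    rw [Tfun, Tfun, tsum_congr (term_tail_comm hω hu Y)]
  have hsmul : ∀ (c : ℂ) Y, Tfun Θ r β ω (c • Y) = c * Tfun Θ r β ω Y := fun c Y => by
    have h : ∀ l, term Θ r β ω (c • Y) l = c * term Θ r β ω Y l := fun l => by
      rw [term_eq, term_eq, mul_smul_comm, smul_mul_assoc, map_smul, smul_eq_mul, mul_left_comm]
    rw [Tfun, Tfun, tsum_congr h, tsum_mul_left, mul_left_comm]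
  rw [gen_add, smul_mul_assoc, mul_smul_comm, hsmul, hsmul, mul_assoc, Tfun_incl_mul, mul_assoc,
    htail, mul_assoc, pairing_add_left, hur, add_zero, weight]
  ring

end Average

/-! ### The KMS condition -/

section KMS

theorem continuous_dyn {n : ℕ} (Θ : Matrix (Fin n) (Fin n) ℝ) (r : Fin n → ℝ) (t : ℝ) :
    Continuous fun X : toeplitz Θ => dyn Θ r t X := by
  refine Continuous.subtype_mk (f := fun X : toeplitz Θ =>
    conj r t (X : Ell2 (Fin n → ℕ) →L[ℂ] Ell2 (Fin n → ℕ))) ?_ _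
  simp only [conj_apply]
  exact (continuous_const.mul continuous_subtype_val).mul continuous_const

/-- An entire function on `ℂ` is determined by its restriction to `ℝ`. -/
theorem eq_of_eq_ofReal {f g : ℂ → ℂ} (hf : Differentiable ℂ f) (hg : Differentiable ℂ g)
    (h : ∀ t : ℝ, f t = g t) : f = g := by
  refine AnalyticOnNhd.eq_of_frequently_eq (z₀ := 0) (fun z _ => hf.analyticAt z)
    (fun z _ => hg.analyticAt z) ?_
  have ht : Filter.Tendsto (fun t : ℝ => (t : ℂ)) (nhdsWithin 0 {0}ᶜ) (nhdsWithin 0 {0}ᶜ) := by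
    refine tendsto_nhdsWithin_iff.mpr ⟨?_, ?_⟩
    · have := Complex.continuous_ofReal.tendsto 0
      rw [Complex.ofReal_zero] at this
      exact this.mono_left nhdsWithin_le_nhds
    · filter_upwards [self_mem_nhdsWithin] with t ht
      simpa using ht
  exact ht.frequently (Filter.Eventually.of_forall h).frequently

variable {n : ℕ} {Θ : Matrix (Fin n) (Fin n) ℝ} {r : Fin n → ℝ} {β : ℝ}

/-- The orbit of an eigenvector extends to `z ↦ exp(i c z) a`, whose value at `iβ` carries the
factor `exp(-β c)`. -/
theorem kms_of_weight {φ : WeakDual ℂ (toeplitz Θ)} (hφ : φ ∈ toeplitzKMS Θ r β)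
    {a : toeplitz Θ} {c : ℝ} (ha : ∀ t : ℝ, dyn Θ r t a = Complex.exp (c * t * Complex.I) • a)
    (b : toeplitz Θ) : φ (a * b) = Real.exp (-(β * c)) * φ (b * a) := by
  have hF : IsEntireOrbit (fun t X => dyn Θ r t X) a
      fun z => Complex.exp (c * z * Complex.I) • a := by
    refine ⟨?_, fun t => (ha t).symm⟩
    exact Differentiable.smul_const (by fun_prop) a
  have h := hφ.2 a b _ hF
  rw [h, mul_smul_comm, map_smul, smul_eq_mul, Complex.ofReal_exp]
  congr 2
  push_cast
  linear_combination (c : ℂ) * β * Complex.I_mul_I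

/-- The elements `b` with `α_t(b) = exp(i c t) b` for some real `c` and all `t` that satisfy the
KMS condition for `φ`. -/
def kmsWeightVectors (r : Fin n → ℝ) (β : ℝ) (φ : WeakDual ℂ (toeplitz Θ)) :
    Submonoid (toeplitz Θ) where
  carrier := {b | ∃ c : ℝ, (∀ t : ℝ, dyn Θ r t b = Complex.exp (c * t * Complex.I) • b) ∧
    ∀ x, φ (b * x) = Real.exp (-(β * c)) * φ (x * b)}
  one_mem' := ⟨0, fun t => by simp, fun x => by simp⟩
  mul_mem' := by
    rintro a b ⟨c, h1, h2⟩ ⟨c', h1', h2'⟩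
    refine ⟨c + c', fun t => ?_, fun x => ?_⟩
    · rw [map_mul, h1, h1', smul_mul_smul_comm, ← Complex.exp_add]
      congr 2
      push_cast
      ring
    · rw [mul_assoc, h2, mul_assoc, h2', ← mul_assoc x, ← mul_assoc, ← Complex.ofReal_mul,
        ← Real.exp_add]
      congr 3
      ring

theorem dyn_gen' (t : ℝ) (p : Fin n → ℕ) :
    dyn Θ r t (gen Θ p) = Complex.exp (pairing p r * t * Complex.I) • gen Θ p := by
  rw [dyn_gen, Circle.coe_exp]
  push_cast
  rfl

theorem dyn_star_gen (t : ℝ) (p : Fin n → ℕ) :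
    dyn Θ r t (star (gen Θ p)) =
      Complex.exp ((-pairing p r : ℝ) * t * Complex.I) • star (gen Θ p) := by
  rw [map_star, dyn_gen', star_smul, Complex.star_def, ← Complex.exp_conj]
  congr 2
  simp

theorem gen_mem_kmsWeightVectors {φ : WeakDual ℂ (toeplitz Θ)}
    (h : ∀ p X, φ (gen Θ p * X) = Real.exp (-(β * pairing p r)) * φ (X * gen Θ p))
    (p : Fin n → ℕ) : gen Θ p ∈ kmsWeightVectors r β φ :=
  ⟨pairing p r, fun t => dyn_gen' t p, h p⟩

/-- Conjugate the relation for `L_p` at `X*`; the scalar is real, and solving for the other side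
inverts it. -/
theorem star_gen_mem_kmsWeightVectors {φ : WeakDual ℂ (toeplitz Θ)}
    (hs : ∀ X, φ (star X) = star (φ X))
    (h : ∀ p X, φ (gen Θ p * X) = Real.exp (-(β * pairing p r)) * φ (X * gen Θ p))
    (p : Fin n → ℕ) : star (gen Θ p) ∈ kmsWeightVectors r β φ := by
  refine ⟨-pairing p r, fun t => dyn_star_gen t p, fun X => ?_⟩
  have h1 := congrArg star (h p (star X))
  rw [← hs, star_mul, star_star, star_mul', ← hs, star_mul, star_star, Complex.star_def,
    Complex.conj_ofReal] at h1
  rw [h1, ← mul_assoc, ← Complex.ofReal_mul, ← Real.exp_add]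
  simp

/-- Taking `x = 1` in the weight relation forces `φ(b) = exp(-β c) φ(b)`, so `φ` vanishes on
eigenvectors with `c ≠ 0`, and those with `c = 0` are fixed. -/
theorem map_dyn_of_gen {φ : WeakDual ℂ (toeplitz Θ)}
    (hs : ∀ X, φ (star X) = star (φ X))
    (h : ∀ p X, φ (gen Θ p * X) = Real.exp (-(β * pairing p r)) * φ (X * gen Θ p))
    (hβ : β ≠ 0) (t : ℝ) (X : toeplitz Θ) : φ (dyn Θ r t X) = φ X := by
  let V : Submodule ℂ (toeplitz Θ) :=
    { carrier := {X | φ (dyn Θ r t X) = φ X}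
      add_mem' := fun {X Y} (hX : φ (dyn Θ r t X) = φ X) (hY : φ (dyn Θ r t Y) = φ Y) => by
        change φ (dyn Θ r t (X + Y)) = φ (X + Y)
        rw [map_add, map_add, map_add, hX, hY]
      zero_mem' := by
        change φ (dyn Θ r t 0) = φ 0
        rw [map_zero]
      smul_mem' := fun c X (hX : φ (dyn Θ r t X) = φ X) => by
        change φ (dyn Θ r t (c • X)) = φ (c • X)
        rw [map_smul, map_smul, map_smul, hX] }
  refine toeplitz_span_induction (kmsWeightVectors r β φ) (gen_mem_kmsWeightVectors h)
    (star_gen_mem_kmsWeightVectors hs h) V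
    (isClosed_eq ((map_continuous φ).comp (continuous_dyn Θ r t)) (map_continuous φ)) ?_ X
  rintro b ⟨c, h1, h2⟩
  change φ (dyn Θ r t b) = φ b
  by_cases hc : c = 0
  · rw [h1, hc]; simp
  · have h3 := h2 1
    rw [mul_one, one_mul] at h3
    have h4 : (1 - (Real.exp (-(β * c)) : ℂ)) * φ b = 0 := by linear_combination h3
    have h5 : φ b = 0 := by
      refine (mul_eq_zero.mp h4).resolve_left fun h6 => ?_
      rw [sub_eq_zero, ← Complex.ofReal_one, Complex.ofReal_inj, eq_comm, Real.exp_eq_one_iff,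
        neg_eq_zero] at h6
      exact (mul_ne_zero hβ hc) h6
    rw [h1, map_smul, h5, smul_zero]

/-- For an eigenvector `b` of weight `c`, invariance of `φ` gives `φ(F(z) b) = exp(-i c z) φ(a b)`
for real `z`, hence for all `z`. At `z = iβ` the factor is `exp(β c)`, exactly undone by moving `b`
to the left. -/
theorem mem_toeplitzKMS_of_gen {φ : WeakDual ℂ (toeplitz Θ)} (hφ : φ ∈ states (toeplitz Θ) 1)
    (h : ∀ p X, φ (gen Θ p * X) = Real.exp (-(β * pairing p r)) * φ (X * gen Θ p))
    (hβ : β ≠ 0) : φ ∈ toeplitzKMS Θ r β := by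
  have hs : ∀ X, φ (star X) = star (φ X) :=
    fun X => map_star_of_nonneg (φ := (WeakDual.toStrongDual φ).toLinearMap) hφ.1 X
  refine ⟨hφ, fun a b F hF => ?_⟩
  -- Density is used only in `b`, with `a` and `F` fixed; approximating `a` would not control `F
  -- (Complex.I * β)`.
  let V : Submodule ℂ (toeplitz Θ) :=
    { carrier := {b | φ (a * b) = φ (b * F (Complex.I * β))}
      add_mem' := fun {b b'} (hb : φ (a * b) = _) (hb' : φ (a * b') = _) => by
        change φ (a * (b + b')) = φ ((b + b') * F (Complex.I * β))
        rw [mul_add, add_mul, map_add, map_add, hb, hb']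
      zero_mem' := by
        change φ (a * 0) = φ (0 * F (Complex.I * β))
        rw [mul_zero, zero_mul]
      smul_mem' := fun c b (hb : φ (a * b) = _) => by
        change φ (a * (c • b)) = φ ((c • b) * F (Complex.I * β))
        rw [mul_smul_comm, smul_mul_assoc, map_smul, map_smul, hb] }
  refine toeplitz_span_induction (kmsWeightVectors r β φ) (gen_mem_kmsWeightVectors h)
    (star_gen_mem_kmsWeightVectors hs h) V
    (isClosed_eq ((map_continuous φ).comp (continuous_const.mul continuous_id))
      ((map_continuous φ).comp (continuous_id.mul continuous_const))) ?_ b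
  rintro b ⟨c, h1, h2⟩
  change φ (a * b) = φ (b * F (Complex.I * β))
  have hG : Differentiable ℂ fun z => φ (F z * b) :=
    (WeakDual.toStrongDual φ).differentiable.comp (hF.1.mul_const b)
  have hH : Differentiable ℂ fun z => Complex.exp (-(c * z * Complex.I)) * φ (a * b) := by
    fun_prop
  have hGH := eq_of_eq_ofReal hG hH fun t => by
    have e1 : dyn Θ r (-t) b = Complex.exp (-(c * t * Complex.I)) • b := by
      rw [h1]; push_cast; congr 2; ring
    have e2 : dyn Θ r t (a * dyn Θ r (-t) b) = dyn Θ r t a * b := by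
      rw [map_mul, ← dyn_add, add_neg_cancel, dyn_zero]
    change φ (F t * b) = _
    rw [hF.2 t, ← e2, map_dyn_of_gen hs h hβ, e1, mul_smul_comm, map_smul, smul_eq_mul]
  have h3 := congrFun hGH (Complex.I * β)
  change φ (F (Complex.I * β) * b) = Complex.exp (-(c * (Complex.I * β) * Complex.I)) * φ (a * b)
    at h3
  rw [h2, h3, ← mul_assoc, Complex.ofReal_exp, ← Complex.exp_add]
  have : ((-(β * c) : ℝ) : ℂ) + -(c * (Complex.I * β) * Complex.I) = 0 := by
    push_cast
    linear_combination -(c : ℂ) * β * Complex.I_mul_I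
  rw [this, Complex.exp_zero, one_mul]

end KMS

/-! ### KMS states and the corner -/

section Fixed

variable {k d : ℕ} (Θ : Matrix (Fin (k + d)) (Fin (k + d)) ℝ) {r : Fin (k + d) → ℝ}

/-- The range of `Q` is spanned by the `δ_q` with `q` supported where `r` vanishes. This is why the
corner is fixed by the dynamics. -/
theorem uOp_mul_Q (hr0 : ∀ j : Fin d, r (Fin.natAdd k j) = 0) (t : ℝ) :
    uOp r t * (Q Θ : Ell2 (Fin (k + d) → ℕ) →L[ℂ] Ell2 (Fin (k + d) → ℕ)) = Q Θ := by
  refine op_ext fun q => ?_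
  rw [mul_apply_eq_comp, Q_delta]
  split_ifs with hq
  · have : pairing q r = 0 := by simp [pairing, Fin.sum_univ_add, hq, hr0]
    simp [uOp_delta, this]
  · rw [map_zero]

theorem Q_mul_uOp (hr0 : ∀ j : Fin d, r (Fin.natAdd k j) = 0) (t : ℝ) :
    (Q Θ : Ell2 (Fin (k + d) → ℕ) →L[ℂ] Ell2 (Fin (k + d) → ℕ)) * uOp r t = Q Θ := by
  refine op_ext fun q => ?_
  rw [mul_apply_eq_comp, uOp_delta, map_smul, Q_delta]
  split_ifs with hq
  · have : pairing q r = 0 := by simp [pairing, Fin.sum_univ_add, hq, hr0]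
    simp [this]
  · rw [smul_zero]

theorem dyn_Q_mul_mul_Q (hr0 : ∀ j : Fin d, r (Fin.natAdd k j) = 0) (t : ℝ) (X : toeplitz Θ) :
    dyn Θ r t (Q Θ * X * Q Θ) = Q Θ * X * Q Θ := by
  refine Subtype.ext ?_
  change conj r t ((Q Θ : Ell2 (Fin (k + d) → ℕ) →L[ℂ] Ell2 (Fin (k + d) → ℕ)) * X * Q Θ) =
    (Q Θ : Ell2 (Fin (k + d) → ℕ) →L[ℂ] Ell2 (Fin (k + d) → ℕ)) * X * Q Θ
  rw [conj_apply, mul_assoc, mul_assoc _ (Q Θ : Ell2 (Fin (k + d) → ℕ) →L[ℂ] _) (uOp r (-t)),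
    Q_mul_uOp Θ hr0, mul_assoc, ← mul_assoc, uOp_mul_Q Θ hr0]

theorem dyn_Q (hr0 : ∀ j : Fin d, r (Fin.natAdd k j) = 0) (t : ℝ) :
    dyn Θ r t (Q Θ) = Q Θ := by
  have h := dyn_Q_mul_mul_Q Θ hr0 t 1
  rwa [mul_one, Q_mul_Q] at h

end Fixed

/-! ### KMS states on products of the defect projections -/

section Factor

variable {n : ℕ} {Θ : Matrix (Fin n) (Fin n) ℝ} {r : Fin n → ℝ} {β : ℝ}

theorem prod_factor_mul_gen (a : Fin n) (l : List (Fin n)) (ha : a ∉ l) :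
    (l.map (factor Θ)).prod * gen Θ (Pi.single a 1) =
      gen Θ (Pi.single a 1) * (l.map (factor Θ)).prod := by
  refine toeplitz_ext fun q => ?_
  have e : (∀ j ∈ l, (Pi.single a 1 + q : Fin n → ℕ) j = 0) ↔ ∀ j ∈ l, q j = 0 := by
    refine forall₂_congr fun j hj => ?_
    have : j ≠ a := fun h => ha (h ▸ hj)
    simp [this]
  rw [coe_mul_delta, coe_mul_delta, gen_delta, map_smul, prod_factor_delta, prod_factor_delta]
  simp only [e]
  split_ifs
  · rw [gen_delta]
  · simp

/-- With `R` the product over the tail, the KMS condition moves `L_{e_a}` to the right of `L_{e_a}*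
R`. As `a` is not in the tail, `L_{e_a}* R L_{e_a} = R`, so each factor contributes `1 - exp(-β
r_a)`. -/
theorem map_prod_factor {φ : WeakDual ℂ (toeplitz Θ)} (hφ : φ ∈ toeplitzKMS Θ r β)
    (l : List (Fin n)) (hl : l.Nodup) :
    φ (l.map (factor Θ)).prod = ((l.map fun j => 1 - Real.exp (-(β * r j))).prod : ℝ) := by
  induction l with
  | nil => simpa using hφ.1.2
  | cons a l ih =>
    obtain ⟨ha, hl⟩ := List.nodup_cons.mp hl
    have hp : pairing (Pi.single a 1 : Fin n → ℕ) r = r a := by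
      rw [pairing, Finset.sum_eq_single a] <;> simp +contextual
    set R := (l.map (factor Θ)).prod with hR
    have h1 : factor Θ a * R = R - gen Θ (Pi.single a 1) * (star (gen Θ (Pi.single a 1)) * R) := by
      rw [factor, sub_mul, one_mul, mul_assoc]
    have h2 := kms_of_weight hφ (fun t => dyn_gen' t (Pi.single a 1))
      (star (gen Θ (Pi.single a 1)) * R)
    have e : star (gen Θ (Pi.single a 1)) * R * gen Θ (Pi.single a 1) = R := by
      rw [mul_assoc, prod_factor_mul_gen a l ha, ← mul_assoc, star_gen_mul_gen_self, one_mul]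
    rw [e, hp] at h2
    rw [List.map_cons, List.prod_cons, ← hR, h1, map_sub, h2, ih hl, List.map_cons,
      List.prod_cons]
    push_cast
    ring

end Factor

/-! ### Recovering a KMS state from its corner -/

section Reconstruction

variable {k d : ℕ} {Θ : Matrix (Fin (k + d)) (Fin (k + d)) ℝ} {r : Fin (k + d) → ℝ} {β : ℝ}
  {φ : WeakDual ℂ (toeplitz Θ)}

theorem map_Q (hφ : φ ∈ toeplitzKMS Θ r β) :
    φ (Q Θ) = (∏ j : Fin k, (1 - Real.exp (-(β * r (Fin.castAdd d j)))) : ℝ) := by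
  have h : Q Θ = ((List.ofFn fun j : Fin k => Fin.castAdd d j).map (factor Θ)).prod := by
    rw [List.map_ofFn]; rfl
  rw [h, map_prod_factor hφ _ (List.nodup_ofFn.mpr (Fin.castAdd_injective k d)), List.map_ofFn,
    List.prod_ofFn]
  rfl

theorem Z_mul_map_Q (hr : ∀ j : Fin k, 0 < r (Fin.castAdd d j)) (hβ : 0 < β)
    (hφ : φ ∈ toeplitzKMS Θ r β) : (Z (d := d) r β : ℂ) * φ (Q Θ) = 1 := by
  rw [map_Q hφ, Z, (hasSum_weight hr hβ).tsum_eq, ← Complex.ofReal_mul, Finset.prod_inv_distrib,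
    inv_mul_cancel₀, Complex.ofReal_one]
  refine Finset.prod_ne_zero_iff.mpr fun j _ => ?_
  have h : Real.exp (-(β * r (Fin.castAdd d j))) < 1 := by
    rw [Real.exp_lt_one_iff]
    have := mul_pos hβ (hr j)
    linarith
  linarith

/-- Corner elements are eigenvectors of weight `0`, for which the KMS condition is the trace
property. -/
theorem map_corner_mul_comm (hr0 : ∀ j : Fin d, r (Fin.natAdd k j) = 0)
    (hφ : φ ∈ toeplitzKMS Θ r β) (x y : cornerQ Θ) :
    φ ((x : toeplitz Θ) * (y : toeplitz Θ)) = φ ((y : toeplitz Θ) * (x : toeplitz Θ)) := by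
  obtain ⟨_, a, rfl⟩ := x
  have h := kms_of_weight (c := 0) hφ (a := Q Θ * a * Q Θ)
    (fun t => by rw [dyn_Q_mul_mul_Q Θ hr0]; simp) (y : toeplitz Θ)
  simpa using h

theorem restrictCorner_mem_cornerTraces (hr : ∀ j : Fin k, 0 < r (Fin.castAdd d j))
    (hr0 : ∀ j : Fin d, r (Fin.natAdd k j) = 0) (hβ : 0 < β) (hφ : φ ∈ toeplitzKMS Θ r β) :
    restrictCorner (Q_isStarProjection Θ) (Z (d := d) r β : ℂ) φ ∈ cornerTraces Θ :=
  restrictCorner_mem_tracialStates (Z_pos hr hβ).le hφ.1.1 (Z_mul_map_Q hr hβ hφ)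
    (map_corner_mul_comm hr0 hφ)

variable (Θ) in
/-- The projection `∑_{l ∈ F} L_l Q L_l*`. -/
def boxProj (F : Finset (Fin k → ℕ)) : toeplitz Θ :=
  ∑ l ∈ F, gen Θ (incl d l) * (Q Θ * star (gen Θ (incl d l)))

theorem star_boxProj (F : Finset (Fin k → ℕ)) : star (boxProj Θ F) = boxProj Θ F := by
  rw [boxProj, star_sum]
  refine Finset.sum_congr rfl fun l _ => ?_
  rw [star_mul, star_mul, star_star, star_Q, mul_assoc]

theorem boxProj_mul_boxProj (F : Finset (Fin k → ℕ)) :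
    boxProj Θ F * boxProj Θ F = boxProj Θ F := by
  have h : ∀ l m : Fin k → ℕ, gen Θ (incl d l) * (Q Θ * star (gen Θ (incl d l))) *
      (gen Θ (incl d m) * (Q Θ * star (gen Θ (incl d m)))) =
      if l = m then gen Θ (incl d l) * (Q Θ * star (gen Θ (incl d l))) else 0 := fun l m => by
    calc _ = gen Θ (incl d l) * (Q Θ * star (gen Θ (incl d l)) * (gen Θ (incl d m) * Q Θ)) *
          star (gen Θ (incl d m)) := by simp only [mul_assoc]
      _ = _ := by
        rw [Q_mul_star_gen_mul_gen_mul_Q]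
        split_ifs with hlm
        · rw [hlm, mul_assoc]
        · rw [mul_zero, zero_mul]
  rw [boxProj, Finset.sum_mul_sum]
  refine Finset.sum_congr rfl fun l hl => ?_
  simp only [h]
  rw [Finset.sum_ite_eq, if_pos hl]

theorem map_mul_boxProj (hr0 : ∀ j : Fin d, r (Fin.natAdd k j) = 0)
    (hφ : φ ∈ toeplitzKMS Θ r β) (X : toeplitz Θ) (F : Finset (Fin k → ℕ)) :
    φ (X * boxProj Θ F) = ∑ l ∈ F, (weight (d := d) r β l : ℂ) *
      φ (Q Θ * (star (gen Θ (incl d l)) * X * gen Θ (incl d l)) * Q Θ) := by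
  rw [boxProj, Finset.mul_sum, map_sum]
  refine Finset.sum_congr rfl fun l _ => ?_
  -- `Q L_l*` has weight `-⟨l, r⟩` because `Q` is fixed; cycling it yields the inverse of the Gibbs
  -- weight.
  have h := kms_of_weight hφ (a := Q Θ * star (gen Θ (incl d l))) (c := -pairing (incl d l) r)
    (fun t => by rw [map_mul, dyn_Q Θ hr0, dyn_star_gen, mul_smul_comm])
    (X * gen Θ (incl d l) * Q Θ)
  have e1 : Q Θ * star (gen Θ (incl d l)) * (X * gen Θ (incl d l) * Q Θ) =
      Q Θ * (star (gen Θ (incl d l)) * X * gen Θ (incl d l)) * Q Θ := by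
    simp only [mul_assoc]
  have e2 : X * gen Θ (incl d l) * Q Θ * (Q Θ * star (gen Θ (incl d l))) =
      X * (gen Θ (incl d l) * (Q Θ * star (gen Θ (incl d l)))) := by
    rw [mul_assoc _ (Q Θ), ← mul_assoc (Q Θ) (Q Θ), Q_mul_Q, mul_assoc]
  rw [e1, e2] at h
  rw [h, weight, ← mul_assoc (Complex.ofReal _), ← Complex.ofReal_mul, ← Real.exp_add]
  simp

theorem tendsto_map_boxProj (hr : ∀ j : Fin k, 0 < r (Fin.castAdd d j))
    (hr0 : ∀ j : Fin d, r (Fin.natAdd k j) = 0) (hβ : 0 < β) (hφ : φ ∈ toeplitzKMS Θ r β) :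
    Filter.Tendsto (fun F => φ (boxProj Θ F)) Filter.atTop (nhds 1) := by
  have h : ∀ F, φ (boxProj Θ F) = ((∑ l ∈ F, weight (d := d) r β l : ℝ) : ℂ) * φ (Q Θ) :=
    fun F => by
      have h := map_mul_boxProj hr0 hφ 1 F
      rw [one_mul] at h
      rw [h, Complex.ofReal_sum, Finset.sum_mul]
      refine Finset.sum_congr rfl fun l _ => ?_
      rw [mul_one, star_gen_mul_gen_self, mul_one, Q_mul_Q]
  simp_rw [h]
  rw [← Z_mul_map_Q hr hβ hφ]
  exact ((Complex.continuous_ofReal.tendsto _).comp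
    (hasSum_weight hr hβ).summable.hasSum).mul_const _

/-- The projections `boxProj Θ F` need not tend to `1` in norm, but their `φ`-mass does tend to `1`,
and by Cauchy–Schwarz this gives `φ(X P_F) → φ(X)`. -/
theorem hasSum_of_mem_kms (hr : ∀ j : Fin k, 0 < r (Fin.castAdd d j))
    (hr0 : ∀ j : Fin d, r (Fin.natAdd k j) = 0) (hβ : 0 < β) (hφ : φ ∈ toeplitzKMS Θ r β)
    (X : toeplitz Θ) :
    HasSum (fun l : Fin k → ℕ => (weight (d := d) r β l : ℂ) *
      φ (Q Θ * (star (gen Θ (incl d l)) * X * gen Θ (incl d l)) * Q Θ)) (φ X) := by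
  have hst : φ ∈ states (toeplitz Θ) 1 := hφ.1
  have hlim : Filter.Tendsto (fun F => φ (X * boxProj Θ F)) Filter.atTop (nhds (φ X)) := by
    rw [tendsto_iff_norm_sub_tendsto_zero]
    have hbound : ∀ F, ‖φ (X * boxProj Θ F) - φ X‖ ≤
        Real.sqrt ((φ (X * star X)).re * (1 - (φ (boxProj Θ F)).re)) := fun F =>
      norm_map_mul_projection_sub_le (φ := (WeakDual.toStrongDual φ).toLinearMap) hst.1 hst.2
        (star_boxProj F) (boxProj_mul_boxProj F) X
    refine squeeze_zero (fun _ => norm_nonneg _) hbound ?_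
    have h1 := (Complex.continuous_re.tendsto _).comp (tendsto_map_boxProj hr hr0 hβ hφ)
    have h2 := (((h1.const_sub 1).const_mul (φ (X * star X)).re).sqrt)
    simpa using h2
  refine hlim.congr fun F => ?_
  rw [map_mul_boxProj hr0 hφ]

theorem Tfun_restrictCorner (hr : ∀ j : Fin k, 0 < r (Fin.castAdd d j))
    (hr0 : ∀ j : Fin d, r (Fin.natAdd k j) = 0) (hβ : 0 < β) (hφ : φ ∈ toeplitzKMS Θ r β)
    (X : toeplitz Θ) :
    Tfun Θ r β (restrictCorner (Q_isStarProjection Θ) (Z (d := d) r β : ℂ) φ) X = φ X := by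
  have h : ∀ l, term Θ r β (restrictCorner (Q_isStarProjection Θ) (Z (d := d) r β : ℂ) φ) X l =
      (Z (d := d) r β : ℂ) * ((weight (d := d) r β l : ℂ) *
        φ (Q Θ * (star (gen Θ (incl d l)) * X * gen Θ (incl d l)) * Q Θ)) := fun l => by
    rw [term_eq, inflate_restrictCorner, mul_left_comm]
  rw [Tfun, tsum_congr h, tsum_mul_left, (hasSum_of_mem_kms hr hr0 hβ hφ X).tsum_eq,
    inv_mul_cancel_left₀ (Complex.ofReal_ne_zero.mpr (Z_pos hr hβ).ne')]

theorem gen_incl_zero : gen Θ (incl d (0 : Fin k → ℕ)) = 1 := by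
  rw [incl_zero]
  exact gen_zero Θ

theorem term_zero (ω : WeakDual ℂ (cornerQ Θ)) (X : toeplitz Θ) :
    term Θ r β ω X 0 = inflate ω X := by
  have e : star (gen Θ (incl d (0 : Fin k → ℕ))) * X * gen Θ (incl d (0 : Fin k → ℕ)) = X := by
    rw [gen_incl_zero, star_one, one_mul, mul_one]
  rw [term_eq, e, weight_zero, Complex.ofReal_one]
  exact one_mul (inflate ω X)

/-- Since `Q L_l = 0` for `l ≠ 0`, a corner element sees only the term `l = 0`. This shows that
restriction inverts `T_β`. -/
theorem Z_mul_Tfun_coe (hr : ∀ j : Fin k, 0 < r (Fin.castAdd d j)) (hβ : 0 < β)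
    (ω : WeakDual ℂ (cornerQ Θ)) (x : cornerQ Θ) :
    (Z (d := d) r β : ℂ) * Tfun Θ r β ω (x : toeplitz Θ) = ω x := by
  have hne : ∀ l : Fin k → ℕ, l ≠ 0 → term Θ r β ω (x : toeplitz Θ) l = 0 := by
    intro l hl
    obtain ⟨_, a, rfl⟩ := x
    have h : star (gen Θ (incl d l)) * (Q Θ * a * Q Θ) * gen Θ (incl d l) = 0 := by
      rw [mul_assoc, mul_assoc _ (Q Θ), Q_mul_gen_incl Θ hl, mul_zero, mul_zero]
    change (weight (d := d) r β l : ℂ) *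
      inflate ω (star (gen Θ (incl d l)) * (Q Θ * a * Q Θ) * gen Θ (incl d l)) = 0
    rw [h, map_zero, mul_zero]
  have h0 : term Θ r β ω (x : toeplitz Θ) 0 = ω x :=
    (term_zero ω (x : toeplitz Θ)).trans (inflate_coe ω x)
  have hs : ∑' l : Fin k → ℕ, term Θ r β ω (x : toeplitz Θ) l = ω x :=
    (tsum_eq_single (0 : Fin k → ℕ) hne).trans h0
  rw [Tfun, mul_inv_cancel_left₀ (Complex.ofReal_ne_zero.mpr (Z_pos hr hβ).ne')]
  exact hs

end Reconstruction

/-! ### Affinity, weak* continuity and the homeomorphism -/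

section Homeomorph

theorem tracialStates_convex {A : Type} [NonUnitalNormedRing A] [StarRing A] [NormedSpace ℂ A]
    {e : A} {φ ψ : WeakDual ℂ A} (hφ : φ ∈ tracialStates A e) (hψ : ψ ∈ tracialStates A e)
    {a b : ℝ} (ha : 0 ≤ a) (hb : 0 ≤ b) (hab : a + b = 1) :
    (a : ℂ) • φ + (b : ℂ) • ψ ∈ tracialStates A e := by
  have h : ∀ x, ((a : ℂ) • φ + (b : ℂ) • ψ) x = a * φ x + b * ψ x := fun x => rfl
  refine ⟨⟨fun x => ?_, ?_⟩, fun x y => ?_⟩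
  · rw [h]
    exact add_nonneg (mul_nonneg (Complex.zero_le_real.mpr ha) (hφ.1.1 x))
      (mul_nonneg (Complex.zero_le_real.mpr hb) (hψ.1.1 x))
  · rw [h, hφ.1.2, hψ.1.2, mul_one, mul_one, ← Complex.ofReal_add, hab, Complex.ofReal_one]
  · rw [h, h, hφ.2, hψ.2]

theorem mul_add_mul_left_comm (w a b x y : ℂ) :
    w * (a * x + b * y) = a * (w * x) + b * (w * y) := by ring

variable {k d : ℕ} {Θ : Matrix (Fin (k + d)) (Fin (k + d)) ℝ} {r : Fin (k + d) → ℝ} {β : ℝ}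

theorem term_add_smul (ω₁ ω₂ : WeakDual ℂ (cornerQ Θ)) (a b : ℂ) (X : toeplitz Θ)
    (l : Fin k → ℕ) : term Θ r β (a • ω₁ + b • ω₂) X l =
      a * term Θ r β ω₁ X l + b * term Θ r β ω₂ X l :=
  mul_add_mul_left_comm _ a b _ _

theorem Tfun_add_smul (hr : ∀ j : Fin k, 0 < r (Fin.castAdd d j)) (hβ : 0 < β)
    {ω₁ ω₂ : WeakDual ℂ (cornerQ Θ)} (h₁ : ω₁ ∈ cornerTraces Θ) (h₂ : ω₂ ∈ cornerTraces Θ)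
    (a b : ℂ) (X : toeplitz Θ) :
    Tfun Θ r β (a • ω₁ + b • ω₂) X = a * Tfun Θ r β ω₁ X + b * Tfun Θ r β ω₂ X := by
  have h := (((summable_term hr hβ h₁ X).hasSum.mul_left a).add
    ((summable_term hr hβ h₂ X).hasSum.mul_left b)).tsum_eq
  have h' := (tsum_congr fun l => term_add_smul (r := r) (β := β) ω₁ ω₂ a b X l).trans h
  exact (congrArg (fun z => (Z (d := d) r β : ℂ)⁻¹ * z) h').trans (mul_add_mul_left_comm _ a b _ _)

theorem Tmap_mem_kms (hr : ∀ j : Fin k, 0 < r (Fin.castAdd d j))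
    (hr0 : ∀ j : Fin d, r (Fin.natAdd k j) = 0) (hβ : 0 < β) {ω : WeakDual ℂ (cornerQ Θ)}
    (hω : ω ∈ cornerTraces Θ) : Tmap hr hβ hω ∈ toeplitzKMS Θ r β :=
  mem_toeplitzKMS_of_gen (Tmap_mem_states hr hβ hω) (Tfun_gen_mul hr0 hω) hβ.ne'

theorem continuous_inflate {A : Type} [NormedRing A] [StarRing A] [NormedAlgebra ℂ A]
    [StarModule ℂ A] {e : A} {he : IsStarProjection e} (a : A) :
    Continuous fun φ : WeakDual ℂ (corner e he) => inflate φ a :=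
  WeakDual.eval_continuous (cornerMap he a)

theorem continuous_restrictCorner {A : Type} [NormedRing A] [StarRing A] [NormedAlgebra ℂ A]
    [StarModule ℂ A] {e : A} (he : IsStarProjection e) (c : ℂ) :
    Continuous fun φ : WeakDual ℂ A => restrictCorner he c φ :=
  WeakDual.continuous_of_continuous_eval fun x =>
    continuous_const.mul (WeakDual.eval_continuous (x : A))

theorem continuous_Tmap (hr : ∀ j : Fin k, 0 < r (Fin.castAdd d j)) (hβ : 0 < β) :
    Continuous fun ω : cornerTraces Θ => Tmap hr hβ ω.2 := by
  refine WeakDual.continuous_of_continuous_eval fun X => ?_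
  -- Weierstrass test: the majorant does not depend on `ω`, since tracial states have norm at most
  -- `1`.
  refine continuous_const.mul (continuous_tsum (u := fun l => weight (d := d) r β l * ‖X‖)
    (fun l => ?_) ((hasSum_weight hr hβ).summable.mul_right ‖X‖)
    fun l ω => norm_term_le ω.2 X l)
  exact continuous_const.mul ((continuous_inflate _).comp continuous_subtype_val)

/-- The affine homeomorphism `T_β` from the tracial states of the corner onto the `KMS_β` states. -/
def kmsHomeomorph (Θ : Matrix (Fin (k + d)) (Fin (k + d)) ℝ)
    (hr : ∀ j : Fin k, 0 < r (Fin.castAdd d j))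
    (hr0 : ∀ j : Fin d, r (Fin.natAdd k j) = 0) (hβ : 0 < β) :
    cornerTraces Θ ≃ₜ toeplitzKMS Θ r β where
  toFun ω := ⟨Tmap hr hβ ω.2, Tmap_mem_kms hr hr0 hβ ω.2⟩
  invFun φ := ⟨restrictCorner (Q_isStarProjection Θ) (Z (d := d) r β : ℂ) φ,
    restrictCorner_mem_cornerTraces hr hr0 hβ φ.2⟩
  left_inv ω := Subtype.ext (DFunLike.ext _ _ fun x => Z_mul_Tfun_coe hr hβ ω.1 x)
  right_inv φ := Subtype.ext (DFunLike.ext _ _ fun X => Tfun_restrictCorner hr hr0 hβ φ.2 X)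
  continuous_toFun := (continuous_Tmap hr hβ).subtype_mk _
  continuous_invFun :=
    ((continuous_restrictCorner _ _).comp continuous_subtype_val).subtype_mk _

end Homeomorph

end

end ToeplitzTorus

theorem mainTheorem3 (k d : ℕ) (Θ : Matrix (Fin (k + d)) (Fin (k + d)) ℝ)
    (hΘ : Θ.transpose = -Θ) (r : Fin (k + d) → ℝ)
    (hr_pos : ∀ j : Fin k, 0 < r (Fin.castAdd d j))
    (hr_zero : ∀ j : Fin d, r (Fin.natAdd k j) = 0) (β : ℝ) (hβ : 0 < β) :
    Summable (fun l : Fin k → ℕ => ToeplitzTorus.weight (d := d) r β l) ∧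
    (∀ ω ∈ ToeplitzTorus.cornerTraces Θ, ∀ X : ToeplitzTorus.toeplitz Θ,
      Summable (fun l : Fin k → ℕ => ToeplitzTorus.term Θ r β ω X l)) ∧
    ∃ T : ToeplitzTorus.cornerTraces Θ ≃ₜ ToeplitzTorus.toeplitzKMS Θ r β,
      (∀ (ω : ToeplitzTorus.cornerTraces Θ) (X : ToeplitzTorus.toeplitz Θ),
        (T ω : WeakDual ℂ (ToeplitzTorus.toeplitz Θ)) X = ToeplitzTorus.Tfun Θ r β ω X) ∧
      ∀ (ω₁ ω₂ : ToeplitzTorus.cornerTraces Θ) (a b : ℝ), 0 ≤ a → 0 ≤ b → a + b = 1 →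
        ∃ h : (a : ℂ) • (ω₁ : WeakDual ℂ (ToeplitzTorus.cornerQ Θ)) + (b : ℂ) • (ω₂ : WeakDual ℂ _)
            ∈ ToeplitzTorus.cornerTraces Θ,
          (T ⟨_, h⟩ : WeakDual ℂ (ToeplitzTorus.toeplitz Θ)) =
            (a : ℂ) • (T ω₁ : WeakDual ℂ _) + (b : ℂ) • (T ω₂ : WeakDual ℂ _) := by
  refine ⟨(ToeplitzTorus.hasSum_weight hr_pos hβ).summable,
    fun ω hω X => ToeplitzTorus.summable_term hr_pos hβ hω X,
    ToeplitzTorus.kmsHomeomorph Θ hr_pos hr_zero hβ, fun ω X => rfl, ?_⟩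
  intro ω₁ ω₂ a b ha hb hab
  exact ⟨ToeplitzTorus.tracialStates_convex ω₁.2 ω₂.2 ha hb hab,
    DFunLike.ext _ _ fun X => ToeplitzTorus.Tfun_add_smul hr_pos hβ ω₁.2 ω₂.2 a b X⟩
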